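/- Consider one licensed sub-band $l_s$ of a seller operator $s$, shared by a finite group $Q_{l_s}$ of operators (mobile network operators, MNOs) with $s\in Q_{l_s}$; the members of $Q_{l_s}\setminus\{s\}$ are buyers, and $b$ is one of them. The base stations (BSs) of the operators $k\in Q_{l_s}$ form independent homogeneous Poisson point processes on $\mathbb{R}^2$ with intensities $\lambda_k>0$. A typical user of $b$ is at the origin. The path loss exponent is $\alpha>2$, the noise power is $\sigma^2\ge 0$, the SINR threshold is $\beta>0$, and the channel gains $h$ between the BSs and the user are i.i.d. exponential with unit mean. BSs of the seller transmit with a fixed power $P^{\rm S}>0$. BSs of the buyers transmit with i.i.d. random powers distributed as $P^{\rm B}_{l_s}=\zeta_s/H$, where $\zeta_s>0$ is the interference threshold of the seller and $H=\sup_i g_i\|{\rm x}-{\rm y}_i\|^{-\alpha}$ is the largest channel gain from a location ${\rm x}$ to the users $({\rm y}_i)$ of the seller, which form a homogeneous Poisson process of intensity $\mu_s>0$, with i.i.d. unit-mean exponential gains $g_i$ independent of the users. (The law of $H$ does not depend on ${\rm x}$.) Positions, gains and powers of the BSs are mutually independent. The user is served by the BS of $b$ with the largest average received power, i.e. the one that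 maximizes $P x^{-\alpha}$ among the BSs of $b$, where $P$ is its transmit power and $x$ its distance from the origin. Let $P_0,h_0,x_0$ be the power, gain and distance of the serving BS, let $I$ be the sum of the powers $P h x^{-\alpha}$ received from all other BSs of $b$, from all BSs of $s$ (with $P=P^{\rm S}$) and from all BSs of the operators in $Q_{l_s}\setminus\{s,b\}$, and let $\gamma=P_0h_0x_0^{-\alpha}/(I+\sigma^2)$. Put $M=\mathbb{E}[(P^{\rm B}_{l_s})^{2/\alpha}]$, $\rho(\alpha,\beta)=\int_{\beta^{-2/\alpha}}^{\infty}\frac{d\nu}{1+\nu^{\alpha/2}}$, $\rho(\alpha,\infty)=\int_0^\infty\frac{d\nu}{1+\nu^{\alpha/2}}$, $\lambda_{b,l_s}=\sum_{k\in Q_{l_s}\setminus\{s,b\}}\lambda_k$, and $$\mathcal{L}(\kappa)=\exp\left(-\pi\lambda_b M\kappa^{2/\alpha}\rho(\alpha,\beta)\right)\exp\left(-\pi\lambda_s (P^{\rm S})^{2/\alpha}\kappa^{2/\alpha}\rho(\alpha,\infty)\right)\exp\left(-\pi\lambda_{b,l_s}M\kappa^{2/\alpha}\rho(\alpha,\infty)\right).$$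 Then $M$ and $\rho(\alpha,\infty)$ are finite, $I<\infty$ almost surely, $\mathcal{L}$ is the Laplace transform of the interference in the sense that, with $Z=x_0^2/P_0^{2/\alpha}$, $$\mathbb{E}\left[e^{-\beta Z^{\alpha/2}I}\,\middle|\,Z\right]=\mathcal{L}\left(\beta Z^{\alpha/2}\right)\quad\text{almost surely},$$ and the coverage probability of the user is given by the convergent integral $$\mathbb{P}[\gamma>\beta]=\int_0^\infty \pi\lambda_b M\,e^{-\beta\sigma^2z^{\alpha/2}}\,e^{-\pi\lambda_b M z}\,\mathcal{L}\left(\beta z^{\alpha/2}\right)dz .$$ -/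

import Mathlib

open MeasureTheory ProbabilityTheory Set
open scoped NNReal ENNReal

noncomputable section

namespace SpectrumSharing

/-- The Euclidean plane. -/
abbrev Plane : Type := EuclideanSpace ℝ (Fin 2)

/-- The number of points of the sequence `X` of random points that fall in `B`. -/
def count {Ω : Type*} (X : ℕ → Ω → Plane) (B : Set Plane) (ω : Ω) : ℕ∞ :=
  {n : ℕ | X n ω ∈ B}.encard

/-- The random points `X 0, X 1, …` enumerate a homogeneous Poisson point process of intensity
`r` on the plane: counts in sets of finite area are Poisson with mean `r * area`, and counts in
pairwise disjoint sets are independent. -/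
structure IsPoissonProcess {Ω : Type*} [MeasurableSpace Ω] (X : ℕ → Ω → Plane) (r : ℝ≥0)
    (P : Measure Ω) : Prop where
  measurable : ∀ n, Measurable (X n)
  count_law : ∀ B : Set Plane, MeasurableSet B → volume B ≠ ∞ →
    P.map (count X B) =
      (poissonMeasure (r * (volume B).toNNReal)).map (fun j : ℕ => (j : ℕ∞))
  count_indep : ∀ (m : ℕ) (B : Fin m → Set Plane), (∀ i, MeasurableSet (B i)) →
    (∀ i, volume (B i) ≠ ∞) → Pairwise (fun i j => Disjoint (B i) (B j)) →
    iIndepFun (fun i => count X (B i)) P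

/-! ### Transmit power of a buyer base station -/

/-- The users `Y` of the seller form a Poisson process of intensity `r`, and the channel gains `g`
between them and a given buyer base station are i.i.d. exponential with unit mean and independent
of the positions of the users. -/
structure IsUserField {Ω : Type*} [MeasurableSpace Ω] (Y : ℕ → Ω → Plane) (g : ℕ → Ω → ℝ)
    (r : ℝ≥0) (P : Measure Ω) : Prop where
  poisson : IsPoissonProcess Y r P
  gain_measurable : ∀ i, Measurable (g i)
  gain_law : ∀ i, HasLaw (g i) (expMeasure 1) P
  gain_indep : iIndepFun g P
  indep : IndepFun (fun ω i => Y i ω) (fun ω i => g i ω) P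

/-- The largest channel gain (path loss included) from a base station at `x` to the users `Y`. -/
def largestGain {Ω : Type*} (α : ℝ) (x : Plane) (Y : ℕ → Ω → Plane) (g : ℕ → Ω → ℝ) (ω : Ω) :
    ℝ≥0∞ :=
  ⨆ i, ENNReal.ofReal (g i ω * ‖x - Y i ω‖ ^ (-α))

/-- The maximum power at which a base station at `x` may transmit so that the interference at
every user in `Y` stays below `ζ`. -/
def maxPower {Ω : Type*} (α ζ : ℝ) (x : Plane) (Y : ℕ → Ω → Plane) (g : ℕ → Ω → ℝ) (ω : Ω) : ℝ :=
  (ENNReal.ofReal ζ / largestGain α x Y g ω).toReal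

/-! ### The downlink on one licensed sub-band, seen from the origin -/

/-- The downlink of one licensed sub-band of one seller. -/
structure Downlink (O Ω : Type*) where
  /-- the operators that share the sub-band -/
  group : Finset O
  /-- the operator that owns the sub-band -/
  seller : O
  /-- intensity of the base stations of each operator -/
  intensity : O → ℝ≥0
  /-- transmit power of the base stations of the seller -/
  sellerPower : ℝ
  /-- path loss exponent -/
  α : ℝ
  /-- the noise power is `σ ^ 2` -/
  σ : ℝ
  /-- `bs k n` is the position of the `n`-th base station of operator `k` -/
  bs : O → ℕ → Ω → Plane
  /-- `gain k n` is the channel gain between that base station and the user at the origin -/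
  gain : O → ℕ → Ω → ℝ
  /-- `power k n` is the transmit power of that base station, where `k` is a buyer -/
  power : O → ℕ → Ω → ℝ

namespace Downlink

variable {O Ω : Type*} (D : Downlink O Ω)

/-- The probabilistic model: independent Poisson processes of base stations, i.i.d. Rayleigh
fading (exponential gains of unit mean), i.i.d. transmit powers of the base stations of the buyers
with common law `powerLaw`, and the families of positions, gains and powers are mutually
independent. -/
structure IsModel [MeasurableSpace Ω] [DecidableEq O] (powerLaw : Measure ℝ) (P : Measure Ω) :
    Prop where
  bs_poisson : ∀ k ∈ D.group, IsPoissonProcess (D.bs k) (D.intensity k) P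
  gain_measurable : ∀ k ∈ D.group, ∀ n, Measurable (D.gain k n)
  gain_law : ∀ k ∈ D.group, ∀ n, HasLaw (D.gain k n) (expMeasure 1) P
  power_measurable : ∀ k ∈ D.group.erase D.seller, ∀ n, Measurable (D.power k n)
  power_law : ∀ k ∈ D.group.erase D.seller, ∀ n, HasLaw (D.power k n) powerLaw P
  bs_indep : iIndepFun (fun (k : D.group) ω n => D.bs k n ω) P
  gain_indep : iIndepFun (fun i : D.group × ℕ => D.gain i.1 i.2) P
  power_indep : iIndepFun (fun i : {k // k ∈ D.group.erase D.seller} × ℕ => D.power i.1 i.2) P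
  gain_power_indep : IndepFun (fun ω (i : D.group × ℕ) => D.gain i.1 i.2 ω)
    (fun ω (i : {k // k ∈ D.group.erase D.seller} × ℕ) => D.power i.1 i.2 ω) P
  bs_marks_indep : IndepFun (fun ω (i : D.group × ℕ) => D.bs i.1 i.2 ω)
    (fun ω => ((fun i : D.group × ℕ => D.gain i.1 i.2 ω),
      (fun i : {k // k ∈ D.group.erase D.seller} × ℕ => D.power i.1 i.2 ω))) P

/-- Average (over the fading) power received at the origin from the `n`-th base station of
buyer `k`. -/
def meanReceived (k : O) (n : ℕ) (ω : Ω) : ℝ :=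
  D.power k n ω * ‖D.bs k n ω‖ ^ (-D.α)

/-- Index of the base station of buyer `b` that serves the user at the origin: the first one that
provides the maximum average received power. -/
def serving (b : O) (ω : Ω) : ℕ :=
  sInf {n : ℕ | ∀ m, D.meanReceived b m ω ≤ D.meanReceived b n ω}

/-- The variable `x₀² / P₀ ^ (2/α)`, where `x₀` is the distance of the serving base station and
`P₀` is its transmit power. -/
def servingZ (b : O) (ω : Ω) : ℝ :=
  ‖D.bs b (D.serving b ω) ω‖ ^ 2 / D.power b (D.serving b ω) ω ^ (2 / D.α)

/-- Power received at the origin from the `n`-th base station of buyer `k`. -/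
def received (k : O) (n : ℕ) (ω : Ω) : ℝ≥0∞ :=
  ENNReal.ofReal (D.power k n ω * D.gain k n ω * ‖D.bs k n ω‖ ^ (-D.α))

/-- Interference at the user of buyer `b` at the origin: from the other base stations of `b`, from
the base stations of the seller, and from those of the other buyers that share the sub-band. -/
def interference [DecidableEq O] (b : O) (ω : Ω) : ℝ≥0∞ :=
  (∑' n : ℕ, if n = D.serving b ω then 0 else D.received b n ω)
    + (∑' n : ℕ, ENNReal.ofReal
        (D.sellerPower * D.gain D.seller n ω * ‖D.bs D.seller n ω‖ ^ (-D.α)))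
    + ∑ k ∈ D.group \ {D.seller, b}, ∑' n : ℕ, D.received k n ω

/-- Signal to interference plus noise ratio at the user of buyer `b` at the origin. -/
def sinr [DecidableEq O] (b : O) (ω : Ω) : ℝ≥0∞ :=
  D.received b (D.serving b ω) ω / (D.interference b ω + ENNReal.ofReal (D.σ ^ 2))

end Downlink

/-! ### The closed form -/

/-- `ρ(α, β)`. -/
def rho (α β : ℝ) : ℝ := ∫ v in Ioi (β ^ (-(2 / α))), 1 / (1 + v ^ (α / 2))

/-- `ρ(α, ∞)`. -/
def rhoInf (α : ℝ) : ℝ := ∫ v in Ioi (0 : ℝ), 1 / (1 + v ^ (α / 2))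

/-- The Laplace transform of the interference in closed form; `M` stands for the moment of order
`2/α` of the transmit power of a base station of a buyer. -/
def laplaceFormula {O Ω : Type*} [DecidableEq O] (D : Downlink O Ω) (b : O) (β M κ : ℝ) : ℝ :=
  Real.exp (-(Real.pi * D.intensity b * M * κ ^ (2 / D.α) * rho D.α β))
    * Real.exp (-(Real.pi * D.intensity D.seller * D.sellerPower ^ (2 / D.α) * κ ^ (2 / D.α)
        * rhoInf D.α))
    * Real.exp (-(Real.pi * (∑ k ∈ D.group \ {D.seller, b}, (D.intensity k : ℝ)) * M
        * κ ^ (2 / D.α) * rhoInf D.α))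

/-- The integrand of the coverage probability in closed form. -/
def coverageIntegrand {O Ω : Type*} [DecidableEq O] (D : Downlink O Ω) (b : O) (β M z : ℝ) : ℝ :=
  Real.pi * D.intensity b * M * Real.exp (-(β * D.σ ^ 2 * z ^ (D.α / 2)))
    * Real.exp (-(Real.pi * D.intensity b * M * z))
    * laplaceFormula D b β M (β * z ^ (D.α / 2))

end SpectrumSharing

end

open SpectrumSharing

/-!
Let `T` be the total power received at the origin, serving base station included, and let `Z` be
the smallest path loss variable `x² / P ^ (2/α)` among the base stations of `b`; it is attained at
the serving base station. The event `{Z > t}` says that no base station of `b` has a path loss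
variable at most `t`, so `exp (-κ T)` restricted to it is again a product over the points of the
independently marked Poisson processes, and the Laplace functional gives
`E[exp (-κ T); Z > t] = exp (-Λ(κ, t))` with an explicit `Λ`.

Write `T = Z ^ (-α/2) h₀ + I`. The gain `h₀` of the serving base station is exponential and
independent of `(Z, I)`, because the selection ignores the gains. Integrating it out turns the
left-hand side into `E[exp (-κ I) (1 - κ / (Z ^ (α/2) + κ)); Z > t]`, and the factor
`1 - κ / (t ^ (α/2) + κ)` also appears in `∂Λ/∂t`. Cancelling it identifies the measure
`E[exp (-κ I); Z ∈ dt]` for each constant `κ`. Simple functions and dominated convergence allow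
`κ = β Z ^ (α/2)`; this is the conditional Laplace transform, and the coverage probability follows
from `P(h₀ > y) = exp (-y)`.
-/

noncomputable section

namespace SpectrumSharing

/-! ### The function `x ↦ e⁻ˣ` on `[0, ∞]` -/

/-- The function `x ↦ e⁻ˣ` on `[0, ∞]`, with value `0` at `∞`. Laplace transforms are stated with
it, so that sums of received powers need not be known to be finite. -/
def expNeg (x : ℝ≥0∞) : ℝ≥0∞ := EReal.exp (-(x : EReal))

/-- The function `q ↦ -log q` on `[0, ∞]`, truncated to `0` for `q ≥ 1`; on `[0, 1]` it is the
inverse of `expNeg`. -/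
def negLog (q : ℝ≥0∞) : ℝ≥0∞ := (-(ENNReal.log q)).toENNReal

@[simp] lemma expNeg_zero : expNeg 0 = 1 := by simp [expNeg]

@[simp] lemma expNeg_top : expNeg ∞ = 0 := by simp [expNeg]

lemma expNeg_ofReal {x : ℝ} (hx : 0 ≤ x) :
    expNeg (ENNReal.ofReal x) = ENNReal.ofReal (Real.exp (-x)) := by
  rw [expNeg, EReal.coe_ennreal_ofReal, max_eq_left hx, ← EReal.coe_neg, EReal.exp_coe]

lemma expNeg_eq_ofReal {x : ℝ≥0∞} (hx : x ≠ ∞) :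
    expNeg x = ENNReal.ofReal (Real.exp (-x.toReal)) := by
  rw [← expNeg_ofReal ENNReal.toReal_nonneg, ENNReal.ofReal_toReal hx]

lemma expNeg_add (x y : ℝ≥0∞) : expNeg (x + y) = expNeg x * expNeg y := by
  rcases eq_or_ne x ∞ with rfl | hx
  · simp
  rcases eq_or_ne y ∞ with rfl | hy
  · simp
  rw [expNeg_eq_ofReal hx, expNeg_eq_ofReal hy, expNeg_eq_ofReal (ENNReal.add_ne_top.2 ⟨hx, hy⟩),
    ENNReal.toReal_add hx hy, neg_add, Real.exp_add, ENNReal.ofReal_mul (Real.exp_nonneg _)]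

lemma expNeg_sum {ι : Type*} (s : Finset ι) (u : ι → ℝ≥0∞) :
    expNeg (∑ i ∈ s, u i) = ∏ i ∈ s, expNeg (u i) := by
  classical
  induction s using Finset.induction_on with
  | empty => simp
  | insert a s ha ih => rw [Finset.sum_insert ha, Finset.prod_insert ha, expNeg_add, ih]

lemma expNeg_mul_natCast (c : ℝ≥0∞) (j : ℕ) : expNeg (c * j) = expNeg c ^ j := by
  simpa [mul_comm c] using expNeg_sum (Finset.range j) fun _ => c

lemma strictAnti_expNeg : StrictAnti expNeg := fun x y hxy => by
  simpa only [expNeg, EReal.exp_lt_exp_iff, EReal.neg_lt_neg_iff,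
    EReal.coe_ennreal_lt_coe_ennreal_iff] using hxy

lemma antitone_expNeg : Antitone expNeg := strictAnti_expNeg.antitone

lemma expNeg_le_one (x : ℝ≥0∞) : expNeg x ≤ 1 := by
  simpa using antitone_expNeg (zero_le (a := x))

lemma expNeg_ne_top (x : ℝ≥0∞) : expNeg x ≠ ∞ :=
  ((expNeg_le_one x).trans_lt ENNReal.one_lt_top).ne

lemma expNeg_eq_zero_iff {x : ℝ≥0∞} : expNeg x = 0 ↔ x = ∞ := by
  rw [← expNeg_top, strictAnti_expNeg.injective.eq_iff]

lemma expNeg_negLog {q : ℝ≥0∞} (hq : q ≤ 1) : expNeg (negLog q) = q := by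
  rw [expNeg, negLog, EReal.coe_toENNReal (by simpa using hq), neg_neg, ENNReal.exp_log]

@[fun_prop]
lemma continuous_expNeg : Continuous expNeg :=
  ENNReal.continuous_exp.comp (continuous_neg.comp continuous_coe_ennreal_ereal)

@[fun_prop]
lemma measurable_expNeg : Measurable expNeg := continuous_expNeg.measurable

@[fun_prop]
lemma measurable_negLog : Measurable negLog :=
  measurable_ereal_toENNReal.comp (continuous_neg.measurable.comp ENNReal.measurable_log)

section Integrals

variable {Ω : Type*} [MeasurableSpace Ω] {P : Measure Ω} [IsProbabilityMeasure P]

lemma lintegral_expNeg_le_one (u : Ω → ℝ≥0∞) : ∫⁻ ω, expNeg (u ω) ∂P ≤ 1 :=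
  (lintegral_mono fun ω => expNeg_le_one (u ω)).trans (by simp)

lemma lintegral_one_sub_expNeg {u : Ω → ℝ≥0∞} (hu : Measurable u) :
    ∫⁻ ω, 1 - expNeg (u ω) ∂P = 1 - ∫⁻ ω, expNeg (u ω) ∂P := by
  rw [lintegral_sub (f := fun _ => 1) (g := fun ω => expNeg (u ω)) (measurable_expNeg.comp hu)
    ((lintegral_expNeg_le_one u).trans_lt ENNReal.one_lt_top).ne
    (.of_forall fun ω => expNeg_le_one _), lintegral_const, measure_univ, mul_one]

lemma ae_eq_zero_of_lintegral_expNeg_eq_one {u : Ω → ℝ≥0∞} (hu : Measurable u)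
    (h : ∫⁻ ω, expNeg (u ω) ∂P = 1) : ∀ᵐ ω ∂P, u ω = 0 := by
  have hzero : ∫⁻ ω, 1 - expNeg (u ω) ∂P = 0 := by rw [lintegral_one_sub_expNeg hu, h, tsub_self]
  filter_upwards [(lintegral_eq_zero_iff (by fun_prop)).1 hzero] with ω hω
  rw [← nonpos_iff_eq_zero, ← strictAnti_expNeg.le_iff_ge, expNeg_zero]
  exact tsub_eq_zero_iff_le.1 hω

lemma ae_ne_top_of_tendsto_lintegral_expNeg {S : Ω → ℝ≥0∞} (hS : Measurable S) {c : ℕ → ℝ≥0∞}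
    (hc : ∀ N, c N ≠ 0)
    (h : Filter.Tendsto (fun N => ∫⁻ ω, expNeg (c N * S ω) ∂P) Filter.atTop (nhds 1)) :
    ∀ᵐ ω ∂P, S ω ≠ ∞ := by
  have hfin : MeasurableSet {ω | S ω ≠ ∞} := (hS (measurableSet_singleton ∞)).compl
  have hbound : ∀ N, ∫⁻ ω, expNeg (c N * S ω) ∂P ≤ P {ω | S ω ≠ ∞} := fun N => by
    rw [← lintegral_indicator_one hfin]
    refine lintegral_mono fun ω => ?_
    by_cases hω : S ω = ∞
    · simp [hω, ENNReal.mul_top (hc N)]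
    · rw [indicator_of_mem (by exact hω)]
      exact expNeg_le_one _
  exact (prob_compl_eq_zero_iff hfin).2 (le_antisymm prob_le_one (le_of_tendsto' h hbound))

end Integrals

lemma lintegral_expNeg_tsum_of_iIndepFun {ι Ω : Type*} [Countable ι] [MeasurableSpace Ω]
    {P : Measure Ω} {u : ι → Ω → ℝ≥0∞} (hu : ∀ i, Measurable (u i)) (hind : iIndepFun u P) :
    ∫⁻ ω, expNeg (∑' i, u i ω) ∂P = expNeg (∑' i, negLog (∫⁻ ω, expNeg (u i ω) ∂P)) := by
  have := hind.isProbabilityMeasure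
  have hL : Filter.Tendsto (fun s : Finset ι => ∫⁻ ω, expNeg (∑ i ∈ s, u i ω) ∂P) Filter.atTop
      (nhds (∫⁻ ω, expNeg (∑' i, u i ω) ∂P)) :=
    tendsto_lintegral_filter_of_dominated_convergence (fun _ => 1)
      (.of_forall fun s => by fun_prop) (.of_forall fun s => .of_forall fun ω => expNeg_le_one _)
      (by simp) (.of_forall fun ω => (continuous_expNeg.tendsto _).comp ENNReal.summable.hasSum)
  have hR : Filter.Tendsto (fun s : Finset ι => expNeg (∑ i ∈ s, negLog (∫⁻ ω, expNeg (u i ω) ∂P)))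
      Filter.atTop (nhds (expNeg (∑' i, negLog (∫⁻ ω, expNeg (u i ω) ∂P)))) :=
    (continuous_expNeg.tendsto _).comp ENNReal.summable.hasSum
  refine tendsto_nhds_unique hL (hR.congr fun s => ?_)
  simp_rw [expNeg_sum, expNeg_negLog (lintegral_expNeg_le_one _)]
  exact (lintegral_prod_eq_prod_lintegral_of_indepFun s (fun i ω => expNeg (u i ω))
    (hind.comp (fun _ => expNeg) fun _ => measurable_expNeg)
    fun i => measurable_expNeg.comp (hu i)).symm

/-! ### Independence and random selection -/

section Independence

variable {Ω β γ δ I J : Type*} [MeasurableSpace Ω] [MeasurableSpace β] [MeasurableSpace γ]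
  [MeasurableSpace δ] {P : Measure Ω}

lemma iIndepFun_of_const_off_range [IsProbabilityMeasure P] {e : J → I}
    (he : Function.Injective e) {u : I → Ω → β} (hJ : iIndepFun (fun j => u (e j)) P)
    (hc : ∀ i ∉ range e, ∃ c, u i = fun _ => c) : iIndepFun u P := by
  classical
  rw [iIndepFun_iff_measure_inter_preimage_eq_mul] at hJ ⊢
  intro S B hB
  by_cases hempty : ∃ i ∈ S, u i ⁻¹' B i = ∅
  · obtain ⟨i, hiS, hi⟩ := hempty
    rw [Finset.prod_eq_zero hiS (by rw [hi, measure_empty])]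
    exact measure_mono_null (biInter_subset_of_mem hiS) (by rw [hi, measure_empty])
  have huniv : ∀ i ∈ S, i ∉ range e → u i ⁻¹' B i = univ := fun i hiS hi => by
    obtain ⟨c, hcc⟩ := hc i hi
    by_cases hcB : c ∈ B i
    · simp [hcc, hcB]
    · exact absurd ⟨i, hiS, by simp [hcc, hcB]⟩ hempty
  have hinter : ⋂ i ∈ S, u i ⁻¹' B i = ⋂ j ∈ S.preimage e he.injOn, u (e j) ⁻¹' B (e j) := by
    ext ω
    simp only [mem_iInter, Finset.mem_preimage]
    refine ⟨fun h j hj => h _ hj, fun h i hi => ?_⟩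
    by_cases hir : i ∈ range e
    · obtain ⟨j, rfl⟩ := hir
      exact h j hi
    · rw [huniv i hi hir]
      trivial
  rw [hinter, hJ _ (sets := fun j => B (e j)) fun j hj => hB _ (Finset.mem_preimage.1 hj)]
  exact Finset.prod_preimage e S he.injOn (fun i => P (u i ⁻¹' B i)) fun i hi hir => by
    rw [huniv i hi hir, measure_univ]

lemma measure_biInter_preimage_prod_eq_mul {u : I → Ω → β} {v : I → Ω → γ}
    (hu : iIndepFun u P) (hv : iIndepFun v P)
    (huv : IndepFun (fun ω i => u i ω) (fun ω i => v i ω) P) (S : Finset I) {A : I → Set β}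
    {B : I → Set γ} (hA : ∀ i ∈ S, MeasurableSet (A i)) (hB : ∀ i ∈ S, MeasurableSet (B i)) :
    P (⋂ i ∈ S, (fun ω => (u i ω, v i ω)) ⁻¹' A i ×ˢ B i)
      = ∏ i ∈ S, P ((fun ω => (u i ω, v i ω)) ⁻¹' A i ×ˢ B i) := by
  have hU : (⋂ i ∈ S, (fun ω => (u i ω, v i ω)) ⁻¹' A i ×ˢ B i)
      = (fun ω i => u i ω) ⁻¹' (⋂ i ∈ S, (fun a => a i) ⁻¹' A i)
        ∩ (fun ω i => v i ω) ⁻¹' (⋂ i ∈ S, (fun a => a i) ⁻¹' B i) := by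
    ext ω
    simp [forall_and]
  have hpair : ∀ i ∈ S, P ((fun ω => (u i ω, v i ω)) ⁻¹' A i ×ˢ B i)
      = P (u i ⁻¹' A i) * P (v i ⁻¹' B i) := fun i hi =>
    (huv.comp (measurable_pi_apply i) (measurable_pi_apply i)).measure_inter_preimage_eq_mul
      _ _ (hA i hi) (hB i hi)
  rw [hU, huv.measure_inter_preimage_eq_mul _ _
    (Finset.measurableSet_biInter _ fun i hi => measurable_pi_apply i (hA i hi))
    (Finset.measurableSet_biInter _ fun i hi => measurable_pi_apply i (hB i hi)),
    Finset.prod_congr rfl hpair, Finset.prod_mul_distrib,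
    ← hu.measure_inter_preimage_eq_mul S hA, ← hv.measure_inter_preimage_eq_mul S hB]
  simp only [preimage_iInter]
  rfl

lemma iIndepFun_prodMk_of_indepFun {u : I → Ω → β} {v : I → Ω → γ}
    (hum : ∀ i, Measurable (u i)) (hvm : ∀ i, Measurable (v i)) (hu : iIndepFun u P)
    (hv : iIndepFun v P) (huv : IndepFun (fun ω i => u i ω) (fun ω i => v i ω) P) :
    iIndepFun (fun i ω => (u i ω, v i ω)) P := by
  rw [iIndepFun_iff_iIndep]
  refine iIndepSets.iIndep (fun i => ((hum i).prodMk (hvm i)).comap_le)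
    (fun i => {s | ∃ t ∈ image2 (· ×ˢ ·) {s : Set β | MeasurableSet s}
        {t : Set γ | MeasurableSet t}, (fun ω => (u i ω, v i ω)) ⁻¹' t = s})
    (fun i => isPiSystem_prod.comap _) (fun i => ?_) ?_
  · rw [← generateFrom_prod, MeasurableSpace.comap_generateFrom]
    rfl
  rw [iIndepSets_iff]
  intro S f hf
  have hrect : ∀ i, ∃ A : Set β, ∃ B : Set γ, i ∈ S →
      MeasurableSet A ∧ MeasurableSet B ∧ f i = (fun ω => (u i ω, v i ω)) ⁻¹' A ×ˢ B := fun i => by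
    by_cases hi : i ∈ S
    · obtain ⟨_, ⟨A, hA, B, hB, rfl⟩, hAB⟩ := hf i hi
      exact ⟨A, B, fun _ => ⟨hA, hB, hAB.symm⟩⟩
    · exact ⟨∅, ∅, fun h => absurd h hi⟩
  choose A B hAB using hrect
  rw [iInter₂_congr fun i hi => (hAB i hi).2.2,
    Finset.prod_congr rfl fun i hi => congrArg P (hAB i hi).2.2]
  exact measure_biInter_preimage_prod_eq_mul hu hv huv S (fun i hi => (hAB i hi).1)
    fun i hi => (hAB i hi).2.1

lemma indepFun_prodMk_right_of_prodMk_left [IsProbabilityMeasure P] {u : Ω → β} {v : Ω → γ}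
    {w : Ω → δ} (hu : Measurable u) (hv : Measurable v) (hw : Measurable w) (huv : IndepFun u v P)
    (huvw : IndepFun (fun ω => (u ω, v ω)) w P) : IndepFun u (fun ω => (v ω, w ω)) P := by
  have hvw : IndepFun v w P := huvw.comp measurable_snd measurable_id
  have := Measure.isProbabilityMeasure_map hu.aemeasurable (μ := P)
  have := Measure.isProbabilityMeasure_map hv.aemeasurable (μ := P)
  have := Measure.isProbabilityMeasure_map hw.aemeasurable (μ := P)
  rw [indepFun_iff_map_prod_eq_prod_map_map hu.aemeasurable (hv.prodMk hw).aemeasurable,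
    hvw.map_prod_eq_prod_map_map hv.aemeasurable hw.aemeasurable,
    ← (measurePreserving_prodAssoc _ _ _).map_eq,
    ← huv.map_prod_eq_prod_map_map hu.aemeasurable hv.aemeasurable,
    ← huvw.map_prod_eq_prod_map_map (hu.prodMk hv).aemeasurable hw.aemeasurable,
    Measure.map_map (by fun_prop) (by fun_prop)]
  rfl

lemma indepFun_restrict_ne {u : I → Ω → β} (hum : ∀ i, Measurable (u i)) (hu : iIndepFun u P)
    (i₀ : I) : IndepFun (u i₀) (fun ω (i : {i // i ≠ i₀}) => u i ω) P := by
  rw [iIndepFun_iff_iIndep] at hu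
  have h := indep_iSup_of_disjoint (fun i => (hum i).comap_le) hu
    (S := {i₀}) (T := {i | i ≠ i₀}) (by simp)
  rw [IndepFun_iff_Indep]
  convert h using 1
  · simp
  · rw [MeasurableSpace.pi, MeasurableSpace.comap_iSup, iSup_subtype]
    simp_rw [MeasurableSpace.comap_comp]
    rfl

lemma measurable_apply_of_countable [Countable I] [MeasurableSpace I] [MeasurableSingletonClass I]
    {N : Ω → I} {F : I → Ω → β} (hN : Measurable N) (hF : ∀ i, Measurable (F i)) :
    Measurable fun ω => F (N ω) ω :=
  (measurable_from_prod_countable_right (f := fun p : I × Ω => F p.1 p.2) hF).comp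
    (hN.prodMk measurable_id)

end Independence

section Selection

variable {Ω β γ : Type*} [MeasurableSpace β] [MeasurableSpace γ]

lemma setLIntegral_comp_prodMk_of_indep {𝓖 mΩ : MeasurableSpace Ω} {P : Measure Ω}
    [IsProbabilityMeasure P] (h𝓖 : 𝓖 ≤ mΩ) {h : Ω → β} {W : Ω → γ} {A : Set Ω} (hh : Measurable h)
    (hind : Indep (MeasurableSpace.comap h inferInstance) 𝓖 P) (hA : MeasurableSet[𝓖] A)
    (hW : Measurable[𝓖] W) {g : β × γ → ℝ≥0∞} (hg : Measurable g) :
    ∫⁻ ω in A, g (h ω, W ω) ∂P = ∫⁻ ω in A, ∫⁻ x, g (x, W ω) ∂(P.map h) ∂P := by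
  have hWm : Measurable W := hW.mono h𝓖 le_rfl
  have : IsProbabilityMeasure (P.map h) := Measure.isProbabilityMeasure_map hh.aemeasurable
  have hjoint : (P.restrict A).map (fun ω => (h ω, W ω))
      = (P.map h).prod ((P.restrict A).map W) := by
    refine (Measure.prod_eq fun s t hs ht => ?_).symm
    rw [Measure.map_apply (hh.prodMk hWm) (hs.prod ht), Measure.map_apply hh hs,
      Measure.map_apply hWm ht, Measure.restrict_apply (hh.prodMk hWm (hs.prod ht)),
      Measure.restrict_apply (hWm ht), mk_preimage_prod, inter_assoc]
    exact Indep_iff _ _ _ |>.1 hind _ _ ⟨s, hs, rfl⟩ ((hW ht).inter hA)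
  rw [← lintegral_map hg (hh.prodMk hWm), hjoint, lintegral_prod_symm' _ hg,
    lintegral_map (by fun_prop) hWm]

-- The index `N` may depend on everything except `h n` on the event `N = n`, so that observing
-- `N` and `W` tells nothing about the selected variable.
lemma lintegral_comp_selected {𝓖 : ℕ → MeasurableSpace Ω} {mΩ : MeasurableSpace Ω}
    {P : Measure Ω} [IsProbabilityMeasure P] (h𝓖 : ∀ n, 𝓖 n ≤ mΩ) {N : Ω → ℕ} {h : ℕ → Ω → β}
    {W : Ω → γ} {V : ℕ → Ω → γ} {μ : Measure β} (hh : ∀ n, Measurable (h n))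
    (hlaw : ∀ n, P.map (h n) = μ)
    (hind : ∀ n, Indep (MeasurableSpace.comap (h n) inferInstance) (𝓖 n) P)
    (hN : ∀ n, MeasurableSet[𝓖 n] {ω | N ω = n}) (hV : ∀ n, Measurable[𝓖 n] (V n))
    (hWV : ∀ ω, W ω = V (N ω) ω) {g : β × γ → ℝ≥0∞} (hg : Measurable g) :
    ∫⁻ ω, g (h (N ω) ω, W ω) ∂P = ∫⁻ ω, ∫⁻ x, g (x, W ω) ∂μ ∂P := by
  have hNm : ∀ n, MeasurableSet {ω | N ω = n} := fun n => h𝓖 n _ (hN n)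
  have hsplit : ∀ F : Ω → ℝ≥0∞, ∫⁻ ω, F ω ∂P = ∑' n, ∫⁻ ω in {ω | N ω = n}, F ω ∂P := fun F => by
    rw [← lintegral_iUnion hNm (fun i j hij => Set.disjoint_left.2
      fun ω (hi : N ω = i) (hj : N ω = j) => hij (hi.symm.trans hj)),
      show (⋃ n, {ω | N ω = n}) = univ by ext ω; simp, setLIntegral_univ]
  rw [hsplit, hsplit]
  refine tsum_congr fun n => ?_
  calc ∫⁻ ω in {ω | N ω = n}, g (h (N ω) ω, W ω) ∂P
      = ∫⁻ ω in {ω | N ω = n}, g (h n ω, V n ω) ∂P :=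
        setLIntegral_congr_fun (hNm n) fun ω (hω : N ω = n) => by simp only [hWV, hω]
    _ = ∫⁻ ω in {ω | N ω = n}, ∫⁻ x, g (x, V n ω) ∂μ ∂P := by
        rw [setLIntegral_comp_prodMk_of_indep (h𝓖 n) (hh n) (hind n) (hN n) (hV n) hg, hlaw]
    _ = ∫⁻ ω in {ω | N ω = n}, ∫⁻ x, g (x, W ω) ∂μ ∂P :=
        setLIntegral_congr_fun (hNm n) fun ω (hω : N ω = n) => by simp only [hWV, hω]

end Selection

section Measures

lemma ext_of_Ioi_of_Iic_eq_zero {ν₁ ν₂ : Measure ℝ} [IsFiniteMeasure ν₁] {a : ℝ}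
    (h₁ : ν₁ (Iic a) = 0) (h₂ : ν₂ (Iic a) = 0) (h : ∀ t, a ≤ t → ν₁ (Ioi t) = ν₂ (Ioi t)) :
    ν₁ = ν₂ := by
  have huniv : ∀ ν : Measure ℝ, ν (Iic a) = 0 → ν univ = ν (Ioi a) := fun ν hν => by
    rw [← Iic_union_Ioi (a := a), measure_union (by simp) measurableSet_Ioi, hν, zero_add]
  have heq : ν₁ univ = ν₂ univ := by rw [huniv _ h₁, huniv _ h₂, h a le_rfl]
  have : IsFiniteMeasure ν₂ := ⟨heq ▸ measure_lt_top ν₁ univ⟩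
  refine Measure.ext_of_Iic _ _ fun t => ?_
  rcases le_total t a with ht | ht
  · rw [measure_mono_null (Iic_subset_Iic.2 ht) h₁, measure_mono_null (Iic_subset_Iic.2 ht) h₂]
  · rw [← compl_Ioi, measure_compl measurableSet_Ioi (measure_ne_top _ _),
      measure_compl measurableSet_Ioi (measure_ne_top _ _), heq, h t ht]

variable {E Ω : Type*} [MeasurableSpace E] [MeasurableSpace Ω] {P : Measure Ω} {μ : Measure E}

lemma withDensity_right_cancel {ν : Measure E} {w : E → ℝ≥0∞} (hw : Measurable w)
    (hμ₀ : ∀ᵐ z ∂μ, w z ≠ 0) (hν₀ : ∀ᵐ z ∂ν, w z ≠ 0) (hw' : ∀ z, w z ≠ ∞)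
    (h : μ.withDensity w = ν.withDensity w) : μ = ν := by
  rw [← withDensity_inv_same hw hμ₀ (.of_forall hw'), h,
    withDensity_inv_same hw hν₀ (.of_forall hw')]

lemma map_withDensity_mul_comp {Z : Ω → E} (hZ : Measurable Z) {w : E → ℝ≥0∞} (hw : Measurable w)
    {F : Ω → ℝ≥0∞} (hF : Measurable F) :
    (P.withDensity fun ω => w (Z ω) * F ω).map Z = ((P.withDensity F).map Z).withDensity w := by
  ext A hA
  rw [Measure.map_apply hZ hA, withDensity_apply _ (hZ hA), withDensity_apply _ hA,
    setLIntegral_map hA hw hZ,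
    setLIntegral_withDensity_eq_setLIntegral_mul P hF (g := fun ω => w (Z ω)) (by fun_prop) (hZ hA)]
  simp only [Pi.mul_apply, mul_comm]

lemma map_withDensity_simpleFunc {C : Type*} {Z : Ω → E} (hZ : Measurable Z)
    {F : C → Ω → ℝ≥0∞} {G : C → E → ℝ≥0∞}
    (h : ∀ c, (P.withDensity (F c)).map Z = μ.withDensity (G c)) (s : SimpleFunc E C) :
    (P.withDensity fun ω => F (s (Z ω)) ω).map Z = μ.withDensity fun u => G (s u) u := by
  classical
  ext A hA
  have hsplit : A = ⋃ c ∈ s.range, A ∩ s ⁻¹' {c} := by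
    ext u
    simp
  have hmeas : ∀ c ∈ s.range, MeasurableSet (A ∩ s ⁻¹' {c}) := fun c _ =>
    hA.inter (s.measurableSet_fiber c)
  have hdisj : (s.range : Set C).PairwiseDisjoint fun c => A ∩ s ⁻¹' {c} := fun c _ d _ hcd =>
    Set.disjoint_left.2 fun u hu hu' => hcd (hu.2.symm.trans hu'.2)
  rw [hsplit, measure_biUnion_finset hdisj hmeas, measure_biUnion_finset hdisj hmeas]
  refine Finset.sum_congr rfl fun c hc => ?_
  have hc' := hmeas c hc
  calc (P.withDensity fun ω => F (s (Z ω)) ω).map Z (A ∩ s ⁻¹' {c})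
      = (P.withDensity (F c)).map Z (A ∩ s ⁻¹' {c}) := by
        rw [Measure.map_apply hZ hc', Measure.map_apply hZ hc', withDensity_apply _ (hZ hc'),
          withDensity_apply _ (hZ hc')]
        exact setLIntegral_congr_fun (hZ hc') fun ω hω => by rw [show s (Z ω) = c from hω.2]
    _ = μ.withDensity (fun u => G (s u) u) (A ∩ s ⁻¹' {c}) := by
        rw [h, withDensity_apply _ hc', withDensity_apply _ hc']
        exact setLIntegral_congr_fun hc' fun u hu => by rw [show s u = c from hu.2]

lemma map_withDensity_of_forall_const {C : Type*} [TopologicalSpace C] [IsFiniteMeasure P]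
    {Z : Ω → E} (hZ : Measurable Z) {F : C → Ω → ℝ≥0∞} {G : C → E → ℝ≥0∞}
    (hFm : ∀ c, Measurable (F c)) (hGm : ∀ c, Measurable (G c))
    (hFc : ∀ᵐ ω ∂P, Continuous fun c => F c ω) (hGc : ∀ᵐ u ∂μ, Continuous fun c => G c u)
    (hF1 : ∀ c ω, F c ω ≤ 1) {B : E → ℝ≥0∞} (hGB : ∀ᵐ u ∂μ, ∀ c, G c u ≤ B u)
    (hB : ∫⁻ u, B u ∂μ ≠ ∞)
    (h : ∀ c, (P.withDensity (F c)).map Z = μ.withDensity (G c)) {κ : E → C}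
    (hκ : StronglyMeasurable κ) :
    (P.withDensity fun ω => F (κ (Z ω)) ω).map Z = μ.withDensity fun u => G (κ u) u := by
  ext A hA
  have hF : Filter.Tendsto (fun n => ∫⁻ ω in Z ⁻¹' A, F (hκ.approx n (Z ω)) ω ∂P) Filter.atTop
      (nhds (∫⁻ ω in Z ⁻¹' A, F (κ (Z ω)) ω ∂P)) :=
    tendsto_lintegral_of_dominated_convergence (fun _ => 1)
      (fun n => ((hκ.approx n).comp Z hZ).measurable_bind F hFm)
      (fun n => .of_forall fun ω => hF1 _ _)
      (by simp) <| ae_restrict_of_ae <| hFc.mono fun ω hω =>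
        (hω.tendsto _).comp (hκ.tendsto_approx (Z ω))
  have hG : Filter.Tendsto (fun n => ∫⁻ u in A, G (hκ.approx n u) u ∂μ) Filter.atTop
      (nhds (∫⁻ u in A, G (κ u) u ∂μ)) :=
    tendsto_lintegral_of_dominated_convergence B
      (fun n => (hκ.approx n).measurable_bind G hGm)
      (fun n => ae_restrict_of_ae <| hGB.mono fun u hu => hu _)
      (ne_top_of_le_ne_top hB (setLIntegral_le_lintegral _ _)) <|
      ae_restrict_of_ae <| hGc.mono fun u hu => (hu.tendsto _).comp (hκ.tendsto_approx u)
  rw [Measure.map_apply hZ hA, withDensity_apply _ (hZ hA), withDensity_apply _ hA]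
  refine tendsto_nhds_unique hF (hG.congr fun n => ?_)
  have hn := congrArg (fun ν : Measure E => ν A) (map_withDensity_simpleFunc hZ h (hκ.approx n))
  simpa only [Measure.map_apply hZ hA, withDensity_apply _ (hZ hA), withDensity_apply _ hA]
    using hn.symm

end Measures

lemma condExp_comap_of_map_withDensity {E Ω : Type*} [MeasurableSpace E] {mΩ : MeasurableSpace Ω}
    {P : Measure Ω} [IsFiniteMeasure P] {Z : Ω → E} (hZ : Measurable Z) {f : Ω → ℝ}
    (hf : Integrable f P) (hf₀ : 0 ≤ᵐ[P] f) {g : E → ℝ} (hg : Measurable g) (hg₀ : ∀ z, 0 ≤ g z)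
    (h : (P.withDensity fun ω => ENNReal.ofReal (f ω)).map Z
      = (P.map Z).withDensity fun z => ENNReal.ofReal (g z)) :
    P[f | MeasurableSpace.comap Z inferInstance] =ᵐ[P] fun ω => g (Z ω) := by
  have hset : ∀ A, MeasurableSet A → ∫⁻ ω in Z ⁻¹' A, ENNReal.ofReal (g (Z ω)) ∂P
      = ∫⁻ ω in Z ⁻¹' A, ENNReal.ofReal (f ω) ∂P := fun A hA => by
    rw [← withDensity_apply (fun ω => ENNReal.ofReal (f ω)) (hZ hA), ← Measure.map_apply hZ hA, h,
      withDensity_apply _ hA, setLIntegral_map hA (by fun_prop) hZ]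
  have hgint : Integrable (fun ω => g (Z ω)) P := by
    refine ⟨(hg.comp hZ).aestronglyMeasurable, ?_⟩
    have huniv := hset univ MeasurableSet.univ
    rw [preimage_univ, Measure.restrict_univ] at huniv
    rw [hasFiniteIntegral_iff_ofReal (.of_forall fun ω => hg₀ _), huniv,
      ← hasFiniteIntegral_iff_ofReal hf₀]
    exact hf.2
  refine (ae_eq_condExp_of_forall_setIntegral_eq hZ.comap_le hf
    (fun s _ _ => hgint.integrableOn) ?_
    (hg.comp (comap_measurable Z)).aestronglyMeasurable).symm
  rintro _ ⟨A, hA, rfl⟩ -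
  rw [integral_eq_lintegral_of_nonneg_ae (.of_forall fun ω => hg₀ _)
      hgint.integrableOn.aestronglyMeasurable,
    integral_eq_lintegral_of_nonneg_ae (ae_restrict_of_ae hf₀)
      hf.integrableOn.aestronglyMeasurable, hset A hA]

/-! ### Radial integrals on the plane -/

lemma volume_norm_sq_le (c : ℝ) :
    volume {y : Plane | ‖y‖ ^ 2 ≤ c} = ENNReal.ofReal (Real.pi * c) := by
  rcases lt_or_ge c 0 with hc | hc
  · have hempty : {y : Plane | ‖y‖ ^ 2 ≤ c} = ∅ := by
      ext y
      simpa using hc.trans_le (sq_nonneg ‖y‖)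
    rw [hempty, measure_empty, ENNReal.ofReal_of_nonpos]
    exact mul_nonpos_of_nonneg_of_nonpos Real.pi_nonneg hc.le
  · have hball : {y : Plane | ‖y‖ ^ 2 ≤ c} = Metric.closedBall 0 (√c) := by
      ext y
      simp [Real.le_sqrt (norm_nonneg y) hc]
    rw [hball, EuclideanSpace.volume_closedBall_fin_two, ← ENNReal.ofReal_pow (Real.sqrt_nonneg _),
      Real.sq_sqrt hc, mul_comm, ENNReal.ofReal_mul Real.pi_nonneg]

lemma map_norm_sq : (volume : Measure Plane).map (fun y => ‖y‖ ^ 2)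
    = ENNReal.ofReal Real.pi • volume.restrict (Ioi (0 : ℝ)) := by
  have hleft : ∀ c : ℝ, (volume : Measure Plane).map (fun y => ‖y‖ ^ 2) (Iic c)
      = ENNReal.ofReal (Real.pi * c) := fun c => by
    rw [Measure.map_apply (by fun_prop) measurableSet_Iic]
    exact volume_norm_sq_le c
  have hright : ∀ c : ℝ, (ENNReal.ofReal Real.pi • volume.restrict (Ioi (0 : ℝ))) (Iic c)
      = ENNReal.ofReal (Real.pi * c) := fun c => by
    rw [Measure.smul_apply, Measure.restrict_apply measurableSet_Iic, Iic_inter_Ioi,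
      Real.volume_Ioc, sub_zero, ENNReal.ofReal_mul Real.pi_nonneg, smul_eq_mul]
  have hIoc : ∀ (ν : Measure ℝ) {a b : ℝ}, a < b → ν (Iic a) ≠ ∞ →
      ν (Ioc a b) = ν (Iic b) - ν (Iic a) := fun ν a b hab ha => by
    rw [← Iic_sdiff_Iic, measure_sdiff (Iic_subset_Iic.2 hab.le)
      measurableSet_Iic.nullMeasurableSet ha]
  refine Measure.ext_of_Ioc' _ _ (fun a b _ => ?_) (fun a b hab => ?_)
  · refine ((measure_mono Ioc_subset_Iic_self).trans_lt ?_).ne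
    rw [hleft]
    exact ENNReal.ofReal_lt_top
  · rw [hIoc _ hab (by simp [hleft]), hIoc _ hab (by rw [hright]; simp), hleft, hleft, hright,
      hright]

lemma setLIntegral_Ioi_comp_div (φ : ℝ → ℝ≥0∞) {a : ℝ} (ha : 0 < a) :
    ∫⁻ u in Ioi (0 : ℝ), φ (u / a) = ENNReal.ofReal a * ∫⁻ u in Ioi (0 : ℝ), φ u := by
  have hemb : MeasurableEmbedding (fun u : ℝ => a * u) :=
    (Homeomorph.mulLeft₀ a ha.ne').measurableEmbedding
  rw [← lintegral_indicator measurableSet_Ioi, ← lintegral_indicator measurableSet_Ioi]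
  conv_lhs => rw [← Real.smul_map_volume_mul_left ha.ne']
  rw [lintegral_smul_measure, hemb.lintegral_map, abs_of_pos ha, smul_eq_mul]
  congr 1
  refine lintegral_congr fun u => ?_
  by_cases hu : 0 < u
  · rw [indicator_of_mem (mem_Ioi.2 (mul_pos ha hu)), indicator_of_mem (mem_Ioi.2 hu),
      mul_div_cancel_left₀ _ ha.ne']
  · rw [indicator_of_notMem (by simpa [ha] using hu), indicator_of_notMem (by simpa using hu)]

lemma lintegral_norm_sq_div {φ : ℝ → ℝ≥0∞} (hφ : Measurable φ) {a : ℝ} (ha : 0 < a) :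
    ∫⁻ y : Plane, φ (‖y‖ ^ 2 / a)
      = ENNReal.ofReal Real.pi * (ENNReal.ofReal a * ∫⁻ u in Ioi (0 : ℝ), φ u) := by
  rw [← lintegral_map (f := fun u => φ (u / a)) (g := fun y : Plane => ‖y‖ ^ 2) (by fun_prop)
    (by fun_prop), map_norm_sq, lintegral_smul_measure, smul_eq_mul, setLIntegral_Ioi_comp_div φ ha]

/-! ### Exponential gains -/

instance : IsProbabilityMeasure (expMeasure 1) := isProbabilityMeasure_expMeasure one_pos

lemma expMeasure_Ioi {a : ℝ} (ha : 0 ≤ a) :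
    expMeasure 1 (Ioi a) = ENNReal.ofReal (Real.exp (-a)) := by
  have h := cdf_expMeasure_eq one_pos a
  rw [if_pos ha, one_mul, cdf_eq_real] at h
  rw [← compl_Iic, prob_compl_eq_one_sub measurableSet_Iic, ← ofReal_measureReal, h,
    ← ENNReal.ofReal_one, ← ENNReal.ofReal_sub _ (by simpa using ha), sub_sub_cancel]

lemma expMeasure_lt_ofReal (a : ℝ≥0∞) : expMeasure 1 {h | a < ENNReal.ofReal h} = expNeg a := by
  rcases eq_or_ne a ∞ with rfl | ha
  · simp
  · have hIoi : {h | a < ENNReal.ofReal h} = Ioi a.toReal := by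
      ext h
      simp [ENNReal.lt_ofReal_iff_toReal_lt ha]
    rw [hIoi, expMeasure_Ioi ENNReal.toReal_nonneg, expNeg_eq_ofReal ha]

lemma ae_pos_expMeasure : ∀ᵐ h ∂(expMeasure 1), 0 < h :=
  (prob_compl_eq_zero_iff (measurableSet_Ioi (a := (0 : ℝ)))).2 <| by
    rw [expMeasure_Ioi le_rfl, neg_zero, Real.exp_zero, ENNReal.ofReal_one]

lemma lintegral_expNeg_mul_expMeasure {s : ℝ} (hs : 0 ≤ s) :
    ∫⁻ h, expNeg (ENNReal.ofReal (s * h)) ∂(expMeasure 1) = ENNReal.ofReal (1 / (1 + s)) := by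
  have hae : ∀ᵐ h ∂(expMeasure 1),
      expNeg (ENNReal.ofReal (s * h)) = ENNReal.ofReal (Real.exp (-(s * h))) := by
    filter_upwards [ae_pos_expMeasure] with h hh using expNeg_ofReal (by positivity)
  have hdensity : (exponentialPDF 1 * fun h => ENNReal.ofReal (Real.exp (-(s * h))))
      = (Ici (0 : ℝ)).indicator fun h => ENNReal.ofReal (Real.exp (-(1 + s) * h)) := by
    ext h
    rw [Pi.mul_apply, exponentialPDF_eq]
    by_cases hh : 0 ≤ h
    · rw [if_pos hh, indicator_of_mem (mem_Ici.2 hh), one_mul, one_mul,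
        ← ENNReal.ofReal_mul (Real.exp_nonneg _), ← Real.exp_add]
      ring_nf
    · rw [if_neg hh, indicator_of_notMem (by simpa using hh), ENNReal.ofReal_zero, zero_mul]
  rw [lintegral_congr_ae hae, show expMeasure 1 = volume.withDensity (exponentialPDF 1) from rfl,
    lintegral_withDensity_eq_lintegral_mul _ (f := exponentialPDF 1)
      (measurable_exponentialPDFReal 1).ennreal_ofReal (by fun_prop), hdensity,
    lintegral_indicator measurableSet_Ici, setLIntegral_congr Ioi_ae_eq_Ici.symm,
    ← ofReal_integral_eq_lintegral_ofReal (integrableOn_exp_mul_Ioi (by linarith) 0)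
      (.of_forall fun h => Real.exp_nonneg _), integral_exp_mul_Ioi (by linarith),
    mul_zero, Real.exp_zero, neg_div_neg_eq]

/-- The mean of `1 - exp (-κ h |w|⁻ᵃ)` for an exponential gain `h` of unit mean, if `w ≠ 0`. The
absolute value makes it continuous on the whole line when `0 < a`. -/
def fadingLoss (a κ w : ℝ) : ℝ := κ / (|w| ^ a + κ)

section FadingLoss

variable {a κ w : ℝ}

lemma fadingLoss_zero (a : ℝ) : fadingLoss a 0 = 0 := funext fun _ => zero_div _

lemma fadingLoss_nonneg (a w : ℝ) (hκ : 0 ≤ κ) : 0 ≤ fadingLoss a κ w := by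
  rw [fadingLoss]
  positivity

lemma fadingLoss_le_one (a w : ℝ) (hκ : 0 ≤ κ) : fadingLoss a κ w ≤ 1 :=
  div_le_one_of_le₀ (le_add_of_nonneg_left (by positivity)) (by positivity)

lemma fadingLoss_lt_one (a : ℝ) (hκ : 0 ≤ κ) (hw : 0 < w) : fadingLoss a κ w < 1 := by
  rw [fadingLoss, div_lt_one (by positivity)]
  exact lt_add_of_pos_left _ (by positivity)

lemma fadingLoss_mono (a w : ℝ) {κ' : ℝ} (hκ : 0 ≤ κ) (h : κ ≤ κ') :
    fadingLoss a κ w ≤ fadingLoss a κ' w := by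
  rcases hκ.eq_or_lt with rfl | hκ
  · simpa [fadingLoss] using fadingLoss_nonneg a w h
  · have hκ' := hκ.trans_le h
    rw [fadingLoss, fadingLoss, div_le_div_iff₀ (by positivity) (by positivity)]
    nlinarith [Real.rpow_nonneg (abs_nonneg w) a]

@[fun_prop]
lemma measurable_fadingLoss (a : ℝ) : Measurable fun q : ℝ × ℝ => fadingLoss a q.1 q.2 := by
  unfold fadingLoss
  fun_prop

lemma continuous_fadingLoss (ha : 0 < a) (hκ : 0 ≤ κ) : Continuous (fadingLoss a κ) := by
  rcases hκ.eq_or_lt with rfl | hκ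
  · simpa only [fadingLoss_zero] using continuous_zero
  · exact continuous_const.div ((continuous_abs.rpow_const fun _ => Or.inr ha.le).add
      continuous_const) fun w => by positivity

lemma continuous_fadingLoss_left (a : ℝ) (hw : 0 < w) :
    Continuous fun κ : ℝ≥0 => fadingLoss a κ w := by
  unfold fadingLoss
  exact NNReal.continuous_coe.div (by fun_prop) fun κ => by positivity

lemma lintegral_expNeg_gain (a : ℝ) (hκ : 0 ≤ κ) (hw : 0 < w) :
    ∫⁻ h, expNeg (ENNReal.ofReal (κ * w ^ (-a) * h)) ∂(expMeasure 1)
      = ENNReal.ofReal (1 - fadingLoss a κ w) := by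
  rw [lintegral_expNeg_mul_expMeasure (by positivity), fadingLoss, abs_of_pos hw,
    Real.rpow_neg hw.le]
  congr 1
  have : 0 < w ^ a := by positivity
  field_simp
  ring

end FadingLoss

/-! ### The integrals `ρ` -/

lemma integrableOn_one_div_one_add_rpow {a : ℝ} (ha : 1 < a) :
    IntegrableOn (fun v : ℝ => 1 / (1 + v ^ a)) (Ioi 0) := by
  have hm : Measurable fun v : ℝ => 1 / (1 + v ^ a) := by fun_prop
  rw [← Ioc_union_Ioi_eq_Ioi zero_le_one, integrableOn_union]
  constructor
  · refine Measure.integrableOn_of_bounded (M := 1) (by simp) hm.aestronglyMeasurable ?_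
    filter_upwards [ae_restrict_mem measurableSet_Ioc] with v hv
    have : 0 ≤ v ^ a := Real.rpow_nonneg hv.1.le _
    rw [Real.norm_of_nonneg (by positivity), div_le_one (by positivity)]
    linarith
  · refine (integrableOn_Ioi_rpow_of_lt (a := -a) (by linarith) one_pos).mono'
      hm.aestronglyMeasurable ?_
    filter_upwards [ae_restrict_mem measurableSet_Ioi] with v hv
    have hv0 : 0 < v := one_pos.trans hv
    have : 0 < v ^ a := Real.rpow_pos_of_pos hv0 _
    rw [Real.norm_of_nonneg (by positivity), Real.rpow_neg hv0.le, one_div]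
    gcongr
    linarith

/-- The value `t + ∫_t^∞ fadingLoss a κ w dw`. Multiplied by `π` and by the intensity and the
`2/α`-moment of the power of an operator, with `a = α/2`, it is minus the logarithm of
`E[e^{-κ T}; Z > t]`, where `T` is the total power received from that operator and `Z` is the
smallest value of `x² / P^{2/α}` among its base stations. -/
def lossIntegral (a κ t : ℝ) : ℝ := t + ∫ w in Ioi t, fadingLoss a κ w

section LossIntegral

variable {a κ t : ℝ}

lemma le_lossIntegral (a t : ℝ) (hκ : 0 ≤ κ) : t ≤ lossIntegral a κ t :=
  le_add_of_nonneg_right (setIntegral_nonneg measurableSet_Ioi fun w _ => fadingLoss_nonneg a w hκ)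

lemma lossIntegral_zero_left (a t : ℝ) : lossIntegral a 0 t = t := by
  simp [lossIntegral, fadingLoss_zero]

lemma fadingLoss_eq_one_div (ha : 0 < a) (hκ : 0 < κ) {w : ℝ} (hw : 0 ≤ w) :
    fadingLoss a κ w = 1 / (1 + (κ ^ (-(1 / a)) * w) ^ a) := by
  have hexp : -(1 / a) * a = -1 := by field_simp
  rw [fadingLoss, abs_of_nonneg hw, Real.mul_rpow (Real.rpow_nonneg hκ.le _) hw,
    ← Real.rpow_mul hκ.le, hexp, Real.rpow_neg_one]
  have : 0 ≤ w ^ a := Real.rpow_nonneg hw a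
  field_simp
  ring

lemma integrableOn_fadingLoss (ha : 1 < a) (hκ : 0 ≤ κ) (t : ℝ) :
    IntegrableOn (fadingLoss a κ) (Ioi t) := by
  have hpos : IntegrableOn (fadingLoss a κ) (Ioi 0) := by
    rcases hκ.eq_or_lt with rfl | hκ
    · rw [fadingLoss_zero]; exact integrableOn_zero
    have hscaled := (integrableOn_Ioi_comp_mul_left_iff (fun v : ℝ => 1 / (1 + v ^ a)) 0
      (Real.rpow_pos_of_pos hκ (-(1 / a)))).2 (by simpa using integrableOn_one_div_one_add_rpow ha)
    exact hscaled.congr_fun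
      (fun w hw => (fadingLoss_eq_one_div (by linarith) hκ (le_of_lt hw)).symm) measurableSet_Ioi
  rcases le_total 0 t with ht | ht
  · exact hpos.mono_set (Ioi_subset_Ioi ht)
  · rw [← Ioc_union_Ioi_eq_Ioi ht]
    exact ((continuous_fadingLoss (by linarith) hκ).integrableOn_Ioc).union hpos

lemma setIntegral_fadingLoss (ha : 0 < a) (hκ : 0 < κ) (ht : 0 ≤ t) :
    ∫ w in Ioi t, fadingLoss a κ w
      = κ ^ (1 / a) * ∫ v in Ioi (κ ^ (-(1 / a)) * t), 1 / (1 + v ^ a) := by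
  have h := integral_comp_mul_left_Ioi (fun v : ℝ => 1 / (1 + v ^ a)) t
    (Real.rpow_pos_of_pos hκ (-(1 / a)))
  rw [← Real.rpow_neg hκ.le, neg_neg, smul_eq_mul] at h
  rw [← h]
  exact setIntegral_congr_fun measurableSet_Ioi fun w hw =>
    fadingLoss_eq_one_div ha hκ (ht.trans (le_of_lt hw))

lemma lossIntegral_zero_right {α : ℝ} (hα : 0 < α) (hκ : 0 < κ) :
    lossIntegral (α / 2) κ 0 = κ ^ (2 / α) * rhoInf α := by
  rw [lossIntegral, setIntegral_fadingLoss (by positivity) hκ le_rfl, mul_zero, one_div_div, rhoInf,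
    zero_add]

lemma lossIntegral_mul_rpow {α β u : ℝ} (hα : 0 < α) (hβ : 0 < β) (hu : 0 < u) :
    lossIntegral (α / 2) (β * u ^ (α / 2)) u = u + (β * u ^ (α / 2)) ^ (2 / α) * rho α β := by
  have hexp : α / 2 * -(2 / α) = -1 := by field_simp
  have hlow : (β * u ^ (α / 2)) ^ (-(2 / α)) * u = β ^ (-(2 / α)) := by
    rw [Real.mul_rpow hβ.le (by positivity), ← Real.rpow_mul hu.le, hexp, Real.rpow_neg_one,
      mul_assoc, inv_mul_cancel₀ hu.ne', mul_one]
  rw [lossIntegral, setIntegral_fadingLoss (by positivity) (by positivity) hu.le, one_div_div, hlow,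
    rho]

lemma setLIntegral_ite_fadingLoss (ha : 1 < a) (hκ : 0 ≤ κ) (ht : 0 ≤ t) :
    ∫⁻ w in Ioi (0 : ℝ), (if w ≤ t then 1 else ENNReal.ofReal (fadingLoss a κ w))
      = ENNReal.ofReal (lossIntegral a κ t) := by
  rw [← Ioc_union_Ioi_eq_Ioi ht, lintegral_union measurableSet_Ioi Ioc_disjoint_Ioi_same,
    setLIntegral_congr_fun (g := fun _ => 1) measurableSet_Ioc (fun w hw => if_pos hw.2),
    setLIntegral_congr_fun (g := fun w => ENNReal.ofReal (fadingLoss a κ w)) measurableSet_Ioi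
      (fun w hw => if_neg (not_le.2 hw)),
    ← ofReal_integral_eq_lintegral_ofReal (integrableOn_fadingLoss ha hκ t)
      (.of_forall fun w => fadingLoss_nonneg a w hκ), setLIntegral_one, Real.volume_Ioc, sub_zero,
    lossIntegral, ENNReal.ofReal_add ht
      (setIntegral_nonneg measurableSet_Ioi fun w _ => fadingLoss_nonneg a w hκ)]

lemma hasDerivAt_lossIntegral (ha : 1 < a) (hκ : 0 ≤ κ) (t : ℝ) :
    HasDerivAt (lossIntegral a κ) (1 - fadingLoss a κ t) t := by
  have heq : lossIntegral a κ = fun u => u + (∫ w in Ioi (0 : ℝ), fadingLoss a κ w)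
      - ∫ w in (0 : ℝ)..u, fadingLoss a κ w := funext fun u => by
    rw [lossIntegral, ← intervalIntegral.integral_Ioi_sub_Ioi' (integrableOn_fadingLoss ha hκ 0)
      (integrableOn_fadingLoss ha hκ u)]
    ring
  rw [heq]
  exact ((hasDerivAt_id t).add_const _).sub
    ((continuous_fadingLoss (by linarith) hκ).integral_hasStrictDerivAt 0 t).hasDerivAt

lemma continuous_lossIntegral_left (ha : 1 < a) (ht : 0 ≤ t) :
    Continuous fun κ : ℝ≥0 => lossIntegral a κ t := by
  refine continuous_const.add (continuous_iff_continuousAt.2 fun κ => ?_)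
  refine continuousAt_of_dominated (bound := fadingLoss a (κ + 1))
    (.of_forall fun κ' => (Measurable.aestronglyMeasurable (by fun_prop))) ?_
    (integrableOn_fadingLoss ha (by positivity) t) ?_
  · filter_upwards [eventually_le_nhds (lt_add_one κ)] with κ' hκ'
    refine .of_forall fun w => ?_
    rw [Real.norm_of_nonneg (fadingLoss_nonneg a w κ'.coe_nonneg)]
    exact fadingLoss_mono a w κ'.coe_nonneg (by exact_mod_cast hκ')
  · filter_upwards [ae_restrict_mem measurableSet_Ioi] with w hw
    exact (continuous_fadingLoss_left a (ht.trans_lt hw)).continuousAt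

@[fun_prop]
lemma measurable_lossIntegral (a : ℝ) : Measurable fun q : ℝ × ℝ => lossIntegral a q.1 q.2 := by
  have hind : Measurable fun p : (ℝ × ℝ) × ℝ =>
      {p : (ℝ × ℝ) × ℝ | p.1.2 < p.2}.indicator (fun p => fadingLoss a p.1.1 p.2) p :=
    Measurable.indicator (by fun_prop) (measurableSet_lt (by fun_prop) (by fun_prop))
  have heq : (fun q : ℝ × ℝ => lossIntegral a q.1 q.2) = fun q => q.2 + ∫ w,
      {p : (ℝ × ℝ) × ℝ | p.1.2 < p.2}.indicator (fun p => fadingLoss a p.1.1 p.2) (q, w) := by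
    funext q
    rw [lossIntegral, ← integral_indicator measurableSet_Ioi]
    rfl
  rw [heq]
  exact measurable_snd.add hind.stronglyMeasurable.integral_prod_right'.measurable

end LossIntegral

lemma lintegral_Ioi_deriv_mul_exp_neg {Λ Λ' : ℝ → ℝ} {t : ℝ}
    (hΛ : ∀ u ∈ Ici t, HasDerivAt Λ (Λ' u) u) (hΛ' : ∀ u ∈ Ioi t, 0 ≤ Λ' u)
    (hlim : Filter.Tendsto Λ Filter.atTop Filter.atTop) :
    ∫⁻ u in Ioi t, ENNReal.ofReal (Λ' u * Real.exp (-Λ u)) = ENNReal.ofReal (Real.exp (-Λ t)) := by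
  have hderiv : ∀ u ∈ Ici t, HasDerivAt (fun u => Real.exp (-Λ u)) (-(Λ' u * Real.exp (-Λ u))) u :=
    fun u hu => by simpa [mul_comm] using (hΛ u hu).fun_neg.exp
  have hnonneg : ∀ u ∈ Ioi t, 0 ≤ Λ' u * Real.exp (-Λ u) := fun u hu =>
    mul_nonneg (hΛ' u hu) (Real.exp_nonneg _)
  have hneg : ∀ u ∈ Ioi t, -(Λ' u * Real.exp (-Λ u)) ≤ 0 := fun u hu => neg_nonpos.2 (hnonneg u hu)
  have htendsto : Filter.Tendsto (fun u => Real.exp (-Λ u)) Filter.atTop (nhds 0) :=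
    Real.tendsto_exp_atBot.comp (Filter.tendsto_neg_atTop_atBot.comp hlim)
  have hint := integral_Ioi_of_hasDerivAt_of_nonpos' hderiv hneg htendsto
  rw [integral_neg, zero_sub, neg_inj] at hint
  rw [← hint, ofReal_integral_eq_lintegral_ofReal
    (by simpa [IntegrableOn] using (integrableOn_Ioi_deriv_of_nonpos' hderiv hneg htendsto).neg)
    ((ae_restrict_mem measurableSet_Ioi).mono hnonneg)]

/-! ### The Laplace functional of a Poisson process -/

lemma lintegral_expNeg_poissonMeasure (m : ℝ≥0) (c : ℝ≥0∞) :
    ∫⁻ j : ℕ, expNeg (c * j) ∂(poissonMeasure m) = expNeg (m * (1 - expNeg c)) := by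
  obtain ⟨q, hq⟩ : ∃ q : ℝ≥0, expNeg c = q := ⟨_, (ENNReal.coe_toNNReal (expNeg_ne_top c)).symm⟩
  have hq1 : q ≤ 1 := by exact_mod_cast hq ▸ expNeg_le_one c
  have hterm : ∀ j : ℕ, expNeg (c * j) * poissonMeasure m {j}
      = ENNReal.ofReal (Real.exp (-m) * ((m * q) ^ j / j.factorial)) := fun j => by
    rw [expNeg_mul_natCast, hq, poissonMeasure_singleton, ← ENNReal.ofReal_coe_nnreal,
      ← ENNReal.ofReal_pow q.coe_nonneg, ← ENNReal.ofReal_mul (by positivity)]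
    congr 1
    ring
  have hsum := (NormedSpace.expSeries_div_hasSum_exp ((m : ℝ) * q)).mul_left (Real.exp (-m))
  have hexponent : (m : ℝ≥0∞) * (1 - q) = ENNReal.ofReal (m * (1 - q)) := by
    rw [ENNReal.ofReal_mul m.coe_nonneg, ENNReal.ofReal_sub _ q.coe_nonneg, ENNReal.ofReal_one,
      ENNReal.ofReal_coe_nnreal, ENNReal.ofReal_coe_nnreal]
  rw [lintegral_countable', tsum_congr hterm,
    ← ENNReal.ofReal_tsum_of_nonneg (fun j => by positivity) hsum.summable, hsum.tsum_eq,
    ← Real.exp_eq_exp_ℝ, ← Real.exp_add, hq, hexponent,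
    expNeg_ofReal (mul_nonneg m.coe_nonneg (sub_nonneg.2 (by exact_mod_cast hq1)))]
  congr 2
  ring

lemma comp_simpleFunc_eq_sum_indicator {E β M : Type*} [MeasurableSpace E] [Zero β]
    [DecidableEq β] [AddCommMonoid M] (φ : SimpleFunc E β) {F : β → M} (hF : F 0 = 0) (x : E) :
    F (φ x) = ∑ c ∈ φ.range with c ≠ 0, (φ ⁻¹' {c}).indicator (fun _ => F c) x := by
  classical
  simp only [indicator_apply, mem_preimage, mem_singleton_iff]
  rw [Finset.sum_ite_eq]
  split_ifs with h
  · rfl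
  · rw [Finset.mem_filter, and_iff_right (φ.mem_range_self x), not_not] at h
    rw [h, hF]

section Poisson

variable {Ω : Type*}

lemma tsum_indicator_eq_count (X : ℕ → Ω → Plane) (B : Set Plane) (c : ℝ≥0∞) (ω : Ω) :
    ∑' n, B.indicator (fun _ => c) (X n ω) = c * (count X B ω : ℝ≥0∞) := by
  rw [count, mul_comm, ← ENNReal.tsum_set_const, tsum_subtype {n | X n ω ∈ B} fun _ => c]
  rfl

variable [MeasurableSpace Ω] {X : ℕ → Ω → Plane} {r : ℝ≥0} {P : Measure Ω}

lemma measurable_mul_count (hX : ∀ n, Measurable (X n)) {B : Set Plane} (hB : MeasurableSet B)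
    (c : ℝ≥0∞) : Measurable fun ω => c * (count X B ω : ℝ≥0∞) := by
  simp_rw [← tsum_indicator_eq_count]
  exact Measurable.tsum fun n => (measurable_const.indicator hB).comp (hX n)

namespace IsPoissonProcess

lemma lintegral_expNeg_count (h : IsPoissonProcess X r P) {B : Set Plane} (hB : MeasurableSet B)
    (hB' : volume B ≠ ∞) (c : ℝ≥0∞) :
    ∫⁻ ω, expNeg (c * (count X B ω : ℝ≥0∞)) ∂P
      = expNeg (r * (volume B * (1 - expNeg c))) := by
  have hlaw := h.count_law B hB hB'
  have := Measure.isProbabilityMeasure_map (μ := poissonMeasure (r * (volume B).toNNReal))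
    (f := fun j : ℕ => (j : ℕ∞)) (by fun_prop)
  have hcount : AEMeasurable (count X B) P :=
    AEMeasurable.of_map_ne_zero (hlaw ▸ IsProbabilityMeasure.ne_zero _)
  rw [← lintegral_map' (f := fun j : ℕ∞ => expNeg (c * (j : ℝ≥0∞))) (by fun_prop) hcount, hlaw,
    lintegral_map (by fun_prop) (by fun_prop)]
  simp only [ENat.toENNReal_coe]
  rw [lintegral_expNeg_poissonMeasure, ENNReal.coe_mul, ENNReal.coe_toNNReal hB', mul_assoc]

variable {ι : Type*} {B : ι → Set Plane}

lemma iIndepFun_count [Finite ι] (h : IsPoissonProcess X r P) (hB : ∀ i, MeasurableSet (B i))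
    (hB' : ∀ i, volume (B i) ≠ ∞) (hdisj : Pairwise fun i j => Disjoint (B i) (B j)) :
    iIndepFun (fun i => count X (B i)) P := by
  let e := Finite.equivFin ι
  have hfin := h.count_indep (Nat.card ι) (fun i => B (e.symm i)) (fun i => hB _) (fun i => hB' _)
    fun i j hij => hdisj (e.symm.injective.ne hij)
  simpa using hfin.precomp e.injective

lemma lintegral_expNeg_sum_count [Fintype ι] (h : IsPoissonProcess X r P)
    (hB : ∀ i, MeasurableSet (B i)) (hB' : ∀ i, volume (B i) ≠ ∞)
    (hdisj : Pairwise fun i j => Disjoint (B i) (B j)) (c : ι → ℝ≥0∞) :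
    ∫⁻ ω, expNeg (∑ i, c i * (count X (B i) ω : ℝ≥0∞)) ∂P
      = expNeg (r * ∑ i, volume (B i) * (1 - expNeg (c i))) := by
  have hind := h.iIndepFun_count hB hB' hdisj
  simp_rw [expNeg_sum]
  rw [lintegral_prod_eq_prod_lintegral_of_indepFun Finset.univ
    (fun i ω => expNeg (c i * (count X (B i) ω : ℝ≥0∞)))
    (hind.comp (fun i (j : ℕ∞) => expNeg (c i * (j : ℝ≥0∞))) fun i => by fun_prop)
    fun i => measurable_expNeg.comp (measurable_mul_count h.measurable (hB i) (c i))]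
  simp_rw [h.lintegral_expNeg_count (hB _) (hB' _)]
  rw [Finset.mul_sum, expNeg_sum]

lemma laplace_simpleFunc (h : IsPoissonProcess X r P) (φ : SimpleFunc Plane ℝ≥0∞)
    (hφ : ∀ c, c ≠ 0 → volume (φ ⁻¹' {c}) ≠ ∞) :
    ∫⁻ ω, expNeg (∑' n, φ (X n ω)) ∂P = expNeg (r * ∫⁻ x, 1 - expNeg (φ x)) := by
  classical
  let s := φ.range.filter (· ≠ 0)
  have hlevel : ∀ c, MeasurableSet (φ ⁻¹' {c}) := fun c => φ.measurableSet_preimage _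
  have hsum : ∀ ω, ∑' n, φ (X n ω) = ∑ c : s, c * (count X (φ ⁻¹' {c.1}) ω : ℝ≥0∞) := fun ω => by
    rw [Finset.sum_coe_sort s fun c => c * (count X (φ ⁻¹' {c}) ω : ℝ≥0∞)]
    simp_rw [← tsum_indicator_eq_count]
    rw [← Summable.tsum_finsetSum fun _ _ => ENNReal.summable]
    exact tsum_congr fun n => comp_simpleFunc_eq_sum_indicator φ (F := id) rfl _
  have hintegral : ∫⁻ x, 1 - expNeg (φ x)
      = ∑ c : s, volume (φ ⁻¹' {c.1}) * (1 - expNeg c) := by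
    rw [Finset.sum_coe_sort s fun c => volume (φ ⁻¹' {c}) * (1 - expNeg c)]
    simp_rw [comp_simpleFunc_eq_sum_indicator φ (F := fun c => 1 - expNeg c) (by simp)]
    rw [lintegral_finsetSum _ fun c _ => measurable_const.indicator (hlevel c)]
    simp_rw [lintegral_indicator_const (hlevel _), mul_comm]
    rfl
  simp_rw [hsum, hintegral]
  exact h.lintegral_expNeg_sum_count (ι := s) (fun c => hlevel c)
    (fun c => hφ c (Finset.mem_filter.1 c.2).2)
    (fun c d hcd => (disjoint_singleton.2 (Subtype.coe_injective.ne hcd)).preimage φ)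
    fun c => c.1

end IsPoissonProcess

lemma exists_monotone_simpleFunc_tendsto {E : Type*} [MeasurableSpace E] (μ : Measure E)
    [SigmaFinite μ] {f : E → ℝ≥0∞} (hf : Measurable f) :
    ∃ φ : ℕ → SimpleFunc E ℝ≥0∞, Monotone φ ∧
      (∀ x, Filter.Tendsto (fun N => φ N x) Filter.atTop (nhds (f x))) ∧
      ∀ N c, c ≠ 0 → μ (φ N ⁻¹' {c}) ≠ ∞ := by
  have hspan := measurableSet_spanningSets μ
  refine ⟨fun N => (SimpleFunc.eapprox f N).restrict (spanningSets μ N), fun N K hNK x => ?_,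
    fun x => ?_, fun N c hc => ?_⟩
  · simp only [SimpleFunc.restrict_apply _ (hspan _)]
    refine (indicator_le_indicator (SimpleFunc.monotone_eapprox f hNK x)).trans ?_
    exact indicator_le_indicator_of_subset (monotone_spanningSets μ hNK) (fun _ => zero_le) x
  · have happrox : Filter.Tendsto (fun N => SimpleFunc.eapprox f N x) Filter.atTop (nhds (f x)) :=
      SimpleFunc.iSup_eapprox_apply hf x ▸
        tendsto_atTop_iSup fun N K hNK => SimpleFunc.monotone_eapprox f hNK x
    refine happrox.congr' ?_
    filter_upwards [Filter.eventually_ge_atTop (spanningSetsIndex μ x)] with N hN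
    rw [SimpleFunc.restrict_apply _ (hspan N),
      indicator_of_mem (mem_spanningSets_of_index_le μ x hN)]
  · rw [SimpleFunc.restrict_preimage_singleton _ (hspan N) hc]
    exact ((measure_mono inter_subset_left).trans_lt (measure_spanningSets_lt_top μ N)).ne

namespace IsPoissonProcess

variable [IsProbabilityMeasure P]

lemma laplace (h : IsPoissonProcess X r P) {f : Plane → ℝ≥0∞} (hf : Measurable f) :
    ∫⁻ ω, expNeg (∑' n, f (X n ω)) ∂P = expNeg (r * ∫⁻ x, 1 - expNeg (f x)) := by
  obtain ⟨φ, hmono, hconv, hfin⟩ := exists_monotone_simpleFunc_tendsto volume hf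
  have hX := h.measurable
  have hsum : ∀ ω, Filter.Tendsto (fun N => ∑' n, φ N (X n ω)) Filter.atTop
      (nhds (∑' n, f (X n ω))) := fun ω => by
    simp_rw [← lintegral_count]
    exact lintegral_tendsto_of_tendsto_of_monotone (fun N => by fun_prop)
      (.of_forall fun n N K hNK => hmono hNK _) (.of_forall fun n => hconv _)
  have hL : Filter.Tendsto (fun N => ∫⁻ ω, expNeg (∑' n, φ N (X n ω)) ∂P) Filter.atTop
      (nhds (∫⁻ ω, expNeg (∑' n, f (X n ω)) ∂P)) :=
    tendsto_lintegral_of_dominated_convergence (fun _ => 1)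
      (fun N => measurable_expNeg.comp (Measurable.tsum fun n => (φ N).measurable.comp (hX n)))
      (fun N => .of_forall fun ω => expNeg_le_one _) (by simp)
      (.of_forall fun ω => (continuous_expNeg.tendsto _).comp (hsum ω))
  have hR : Filter.Tendsto (fun N => ∫⁻ x, 1 - expNeg (φ N x)) Filter.atTop
      (nhds (∫⁻ x, 1 - expNeg (f x))) :=
    lintegral_tendsto_of_tendsto_of_monotone (fun N => by fun_prop)
      (.of_forall fun x N K hNK => tsub_le_tsub_left (antitone_expNeg (hmono hNK x)) _)
      (.of_forall fun x => ENNReal.Tendsto.sub tendsto_const_nhds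
        ((continuous_expNeg.tendsto _).comp (hconv x)) (.inl ENNReal.one_ne_top))
  refine tendsto_nhds_unique hL ?_
  simp_rw [fun N => h.laplace_simpleFunc (φ N) (hfin N)]
  exact (continuous_expNeg.tendsto _).comp
    (ENNReal.Tendsto.const_mul hR (.inr ENNReal.coe_ne_top))

lemma ae_ne (h : IsPoissonProcess X r P) (x : Plane) : ∀ᵐ ω ∂P, ∀ n, X n ω ≠ x := by
  have hx := measurableSet_singleton x
  have hlaplace := h.lintegral_expNeg_count hx (by simp) ∞
  rw [measure_singleton, zero_mul, mul_zero, expNeg_zero] at hlaplace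
  filter_upwards [ae_eq_zero_of_lintegral_expNeg_eq_one
    (measurable_mul_count h.measurable hx ∞) hlaplace] with ω hω n hn
  rw [← tsum_indicator_eq_count, ENNReal.tsum_eq_zero] at hω
  simpa [hn] using hω n

end IsPoissonProcess

end Poisson

/-! ### Independently marked Poisson processes -/

section MarkedPoisson

variable {ι Ω E : Type*} [MeasurableSpace Ω] [MeasurableSpace E]

/-- The cost `f` of a marked point at `x`, averaged over the law `ν` of its mark in the sense of
Laplace transforms. -/
def averageCost (ν : Measure E) (f : Plane × E → ℝ≥0∞) (x : Plane) : ℝ≥0∞ :=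
  negLog (∫⁻ e, expNeg (f (x, e)) ∂ν)

lemma measurable_averageCost (ν : Measure E) [SFinite ν] {f : Plane × E → ℝ≥0∞}
    (hf : Measurable f) : Measurable (averageCost ν f) :=
  measurable_negLog.comp (measurable_expNeg.comp hf).lintegral_prod_right'

lemma one_sub_expNeg_averageCost (ν : Measure E) [IsProbabilityMeasure ν]
    {f : Plane × E → ℝ≥0∞} (hf : Measurable f) (x : Plane) :
    1 - expNeg (averageCost ν f x) = ∫⁻ e, 1 - expNeg (f (x, e)) ∂ν := by
  rw [averageCost, expNeg_negLog (lintegral_expNeg_le_one _),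
    lintegral_one_sub_expNeg (u := fun e => f (x, e)) (hf.comp measurable_prodMk_left)]

/-- Independent Poisson processes `X k` of intensities `r k`, the points of which carry independent
marks that are independent of the positions; the marks of the process `k` have law `ν k`. -/
structure IsMarkedPoisson (X : ι → ℕ → Ω → Plane) (m : ι → ℕ → Ω → E) (r : ι → ℝ≥0)
    (ν : ι → Measure E) (P : Measure Ω) : Prop where
  poisson : ∀ k, IsPoissonProcess (X k) (r k) P
  indep : iIndepFun (fun k ω n => X k n ω) P
  mark_measurable : ∀ k n, Measurable (m k n)
  mark_law : ∀ k n, P.map (m k n) = ν k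
  mark_indep : iIndepFun (fun i : ι × ℕ => m i.1 i.2) P
  indep_mark : IndepFun (fun ω (i : ι × ℕ) => X i.1 i.2 ω) (fun ω (i : ι × ℕ) => m i.1 i.2 ω) P

namespace IsMarkedPoisson

variable {X : ι → ℕ → Ω → Plane} {m : ι → ℕ → Ω → E} {r : ι → ℝ≥0} {ν : ι → Measure E}
  {P : Measure Ω}

lemma measurable_tsum (h : IsMarkedPoisson X m r ν P) (k : ι) {f : Plane × E → ℝ≥0∞}
    (hf : Measurable f) : Measurable fun ω => ∑' n, f (X k n ω, m k n ω) :=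
  Measurable.tsum fun n => hf.comp (((h.poisson k).measurable n).prodMk (h.mark_measurable k n))

lemma lintegral_expNeg_tsum_mark [Finite ι] (h : IsMarkedPoisson X m r ν P)
    {f : ι → Plane × E → ℝ≥0∞} (hf : ∀ k, Measurable (f k)) (a : ι × ℕ → Plane) :
    ∫⁻ ω, expNeg (∑' i : ι × ℕ, f i.1 (a i, m i.1 i.2 ω)) ∂P
      = expNeg (∑' i : ι × ℕ, averageCost (ν i.1) (f i.1) (a i)) := by
  have hcost : ∀ i : ι × ℕ, Measurable fun e => f i.1 (a i, e) := fun i =>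
    (hf i.1).comp measurable_prodMk_left
  rw [lintegral_expNeg_tsum_of_iIndepFun (u := fun (i : ι × ℕ) ω => f i.1 (a i, m i.1 i.2 ω))
    (fun i => (hcost i).comp (h.mark_measurable i.1 i.2))
    (h.mark_indep.comp (fun i e => f i.1 (a i, e)) hcost)]
  refine congrArg expNeg (tsum_congr fun i => ?_)
  rw [averageCost, ← h.mark_law i.1 i.2, lintegral_map (f := fun e => expNeg (f i.1 (a i, e)))
    (measurable_expNeg.comp (hcost i)) (h.mark_measurable i.1 i.2)]

variable [IsProbabilityMeasure P]

lemma isProbabilityMeasure (h : IsMarkedPoisson X m r ν P) (k : ι) :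
    IsProbabilityMeasure (ν k) := by
  rw [← h.mark_law k 0]
  exact Measure.isProbabilityMeasure_map (h.mark_measurable k 0).aemeasurable

lemma lintegral_expNeg_tsum_averageCost [Finite ι] (h : IsMarkedPoisson X m r ν P)
    {f : ι → Plane × E → ℝ≥0∞} (hf : ∀ k, Measurable (f k)) :
    ∫⁻ ω, expNeg (∑' i : ι × ℕ, f i.1 (X i.1 i.2 ω, m i.1 i.2 ω)) ∂P
      = ∫⁻ ω, expNeg (∑' i : ι × ℕ, averageCost (ν i.1) (f i.1) (X i.1 i.2 ω)) ∂P := by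
  let W : Ω → ι × ℕ → Plane := fun ω i => X i.1 i.2 ω
  let μ : Ω → ι × ℕ → E := fun ω i => m i.1 i.2 ω
  let Φ : (ι × ℕ → E) × (ι × ℕ → Plane) → ℝ≥0∞ := fun p => expNeg (∑' i, f i.1 (p.2 i, p.1 i))
  have hW : Measurable W := measurable_pi_lambda _ fun i => (h.poisson i.1).measurable i.2
  have hμ : Measurable μ := measurable_pi_lambda _ fun i => h.mark_measurable i.1 i.2
  have hΦ : Measurable Φ :=
    measurable_expNeg.comp (Measurable.tsum fun i => (hf i.1).comp (by fun_prop))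
  have hcond := setLIntegral_comp_prodMk_of_indep hW.comap_le (A := univ) hμ
    ((IndepFun_iff_Indep _ _ _).1 h.indep_mark.symm) MeasurableSet.univ (comap_measurable W) hΦ
  simp only [setLIntegral_univ] at hcond
  refine hcond.trans (lintegral_congr fun ω => ?_)
  rw [lintegral_map (f := fun x => Φ (x, W ω)) (hΦ.comp measurable_prodMk_right) hμ]
  exact h.lintegral_expNeg_tsum_mark hf (W ω)

lemma laplace [Fintype ι] (h : IsMarkedPoisson X m r ν P) {f : ι → Plane × E → ℝ≥0∞}
    (hf : ∀ k, Measurable (f k)) :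
    ∫⁻ ω, expNeg (∑ k, ∑' n, f k (X k n ω, m k n ω)) ∂P
      = expNeg (∑ k, r k * ∫⁻ x, ∫⁻ e, 1 - expNeg (f k (x, e)) ∂(ν k)) := by
  have := h.isProbabilityMeasure
  have hF := fun k => measurable_averageCost (ν k) (hf k)
  have hcost : ∀ k, Measurable fun a : ℕ → Plane => expNeg (∑' n, averageCost (ν k) (f k) (a n)) :=
    fun k => measurable_expNeg.comp (Measurable.tsum fun n => (hF k).comp (measurable_pi_apply n))
  calc ∫⁻ ω, expNeg (∑ k, ∑' n, f k (X k n ω, m k n ω)) ∂P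
      = ∫⁻ ω, ∏ k, expNeg (∑' n, averageCost (ν k) (f k) (X k n ω)) ∂P := by
        simpa only [ENNReal.tsum_prod', tsum_fintype, expNeg_sum]
          using h.lintegral_expNeg_tsum_averageCost hf
    _ = ∏ k, ∫⁻ ω, expNeg (∑' n, averageCost (ν k) (f k) (X k n ω)) ∂P :=
        lintegral_prod_eq_prod_lintegral_of_indepFun Finset.univ
          (fun k ω => expNeg (∑' n, averageCost (ν k) (f k) (X k n ω)))
          (h.indep.comp _ hcost)
          (fun k => (hcost k).comp (measurable_pi_lambda _ fun n => (h.poisson k).measurable n))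
    _ = expNeg (∑ k, r k * ∫⁻ x, ∫⁻ e, 1 - expNeg (f k (x, e)) ∂(ν k)) := by
        simp_rw [(h.poisson _).laplace (hF _), one_sub_expNeg_averageCost _ (hf _), expNeg_sum]

lemma laplace_single [Finite ι] (h : IsMarkedPoisson X m r ν P) (k : ι) {f : Plane × E → ℝ≥0∞}
    (hf : Measurable f) :
    ∫⁻ ω, expNeg (∑' n, f (X k n ω, m k n ω)) ∂P
      = expNeg (r k * ∫⁻ x, ∫⁻ e, 1 - expNeg (f (x, e)) ∂(ν k)) := by
  classical
  have := Fintype.ofFinite ι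
  have hsingle := h.laplace (f := Pi.single k f) fun j => by
    rcases eq_or_ne j k with rfl | hj
    · rwa [Pi.single_eq_same]
    · rw [Pi.single_eq_of_ne hj]
      exact measurable_const
  have hsum : ∀ ω, ∑ j, ∑' n, Pi.single (M := fun _ => Plane × E → ℝ≥0∞) k f j (X j n ω, m j n ω)
      = ∑' n, f (X k n ω, m k n ω) := fun ω => by
    rw [Finset.sum_eq_single k (fun j _ hj => by simp [hj]) (by simp), Pi.single_eq_same]
  simp_rw [hsum] at hsingle
  rw [hsingle, Finset.sum_eq_single k (fun j _ hj => by simp [hj]) (by simp), Pi.single_eq_same]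

lemma measure_forall_notMem [Finite ι] (h : IsMarkedPoisson X m r ν P) (k : ι)
    {A : Set (Plane × E)} (hA : MeasurableSet A) :
    P {ω | ∀ n, (X k n ω, m k n ω) ∉ A} = expNeg (r k * (volume.prod (ν k)) A) := by
  have := h.isProbabilityMeasure k
  let f : Plane × E → ℝ≥0∞ := A.indicator fun _ => ∞
  have hf : Measurable f := measurable_const.indicator hA
  have hvoid : MeasurableSet {ω | ∀ n, (X k n ω, m k n ω) ∉ A} := by
    simp_rw [ofPred_forall]
    exact .iInter fun n => (((h.poisson k).measurable n).prodMk (h.mark_measurable k n)) hA.compl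
  have hind : ∀ ω, expNeg (∑' n, f (X k n ω, m k n ω))
      = {ω | ∀ n, (X k n ω, m k n ω) ∉ A}.indicator 1 ω := fun ω => by
    by_cases hω : ∀ n, (X k n ω, m k n ω) ∉ A
    · simp [f, hω]
    · obtain ⟨n, hn⟩ := not_forall_not.1 hω
      rw [indicator_of_notMem (by exact hω), expNeg_eq_zero_iff]
      exact ENNReal.tsum_eq_top_of_eq_top ⟨n, indicator_of_mem hn _⟩
  have hcost : ∀ p, 1 - expNeg (f p) = A.indicator 1 p := fun p => by
    by_cases hp : p ∈ A <;> simp [f, hp]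
  rw [← lintegral_indicator_one hvoid, ← lintegral_congr hind, h.laplace_single k hf,
    ← lintegral_indicator_one hA, ← lintegral_congr hcost, lintegral_prod _ (by fun_prop)]

lemma ae_tsum_ne_top [Finite ι] (h : IsMarkedPoisson X m r ν P) (k : ι) {f : Plane × E → ℝ≥0∞}
    (hf : Measurable f) (hfin : ∀ p, f p ≠ ∞)
    (hint : ∫⁻ x, ∫⁻ e, 1 - expNeg (f (x, e)) ∂(ν k) ≠ ∞) :
    ∀ᵐ ω ∂P, ∑' n, f (X k n ω, m k n ω) ≠ ∞ := by
  have := h.isProbabilityMeasure k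
  let c : ℕ → ℝ≥0∞ := fun N => ((N + 1 : ℕ) : ℝ≥0∞)⁻¹
  have hc₀ : Filter.Tendsto c Filter.atTop (nhds 0) :=
    (Filter.tendsto_add_atTop_iff_nat 1).2 ENNReal.tendsto_inv_nat_nhds_zero
  have hc₁ : ∀ N, c N ≤ 1 := fun N => ENNReal.inv_le_one.2 (by exact_mod_cast Nat.le_add_left 1 N)
  have hlaplace : ∀ N, ∫⁻ ω, expNeg (c N * ∑' n, f (X k n ω, m k n ω)) ∂P
      = expNeg (r k * ∫⁻ p, 1 - expNeg (c N * f p) ∂(volume.prod (ν k))) := fun N => by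
    rw [lintegral_prod _ (by fun_prop), ← h.laplace_single k (hf.const_mul (c N))]
    simp_rw [ENNReal.tsum_mul_left]
  have hlim : Filter.Tendsto (fun N => ∫⁻ p, 1 - expNeg (c N * f p) ∂(volume.prod (ν k)))
      Filter.atTop (nhds (∫⁻ _, 0 ∂((volume : Measure Plane).prod (ν k)))) := by
    refine tendsto_lintegral_of_dominated_convergence (fun p => 1 - expNeg (f p))
      (fun N => by fun_prop) (fun N => .of_forall fun p => ?_) ?_ (.of_forall fun p => ?_)
    · exact tsub_le_tsub_left (antitone_expNeg (mul_le_of_le_one_left' (hc₁ N))) _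
    · rwa [lintegral_prod _ (by fun_prop)]
    · have harg : Filter.Tendsto (fun N => c N * f p) Filter.atTop (nhds 0) := by
        simpa only [zero_mul] using ENNReal.Tendsto.mul_const hc₀ (.inr (hfin p))
      simpa using ENNReal.Tendsto.sub (tendsto_const_nhds (x := (1 : ℝ≥0∞)))
        ((continuous_expNeg.tendsto _).comp harg) (.inl ENNReal.one_ne_top)
  refine ae_ne_top_of_tendsto_lintegral_expNeg (h.measurable_tsum k hf) (c := c)
    (fun N => ENNReal.inv_ne_zero.2 (ENNReal.natCast_ne_top _)) ?_
  simp_rw [hlaplace]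
  rw [lintegral_zero] at hlim
  simpa [Function.comp_def] using (continuous_expNeg.tendsto _).comp
    (ENNReal.Tendsto.const_mul hlim (.inr (ENNReal.coe_ne_top (r := r k))))

end IsMarkedPoisson

end MarkedPoisson

/-- The cost attached to a base station at `x` with gain `h` and power `p`: infinite if its path
loss variable `‖x‖² / p ^ (2/α)` is at most `t`, and `κ` times its received power otherwise. -/
def bsCost (α κ t : ℝ) (q : Plane × (ℝ × ℝ)) : ℝ≥0∞ :=
  (if ‖q.1‖ ^ 2 / q.2.2 ^ (2 / α) ≤ t then ∞ else 0)
    + ENNReal.ofReal (κ * (q.2.2 * q.2.1 * ‖q.1‖ ^ (-α)))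

@[fun_prop]
lemma measurable_bsCost (α κ t : ℝ) : Measurable (bsCost α κ t) := by
  refine Measurable.add (Measurable.ite (measurableSet_le ?_ measurable_const) measurable_const
    measurable_const) ?_ <;> fun_prop

section BaseStationCost

variable {α κ t : ℝ}

lemma sq_div_rpow_rpow {x p : ℝ} (hα : α ≠ 0) (hx : 0 ≤ x) (hp : 0 ≤ p) :
    (x ^ 2 / p ^ (2 / α)) ^ (α / 2) = x ^ α / p := by
  rw [Real.div_rpow (by positivity) (by positivity), ← Real.rpow_natCast, ← Real.rpow_mul hx,
    ← Real.rpow_mul hp, Nat.cast_ofNat, mul_div_cancel₀ α two_ne_zero,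
    div_mul_div_comm, mul_comm 2 α, div_self (mul_ne_zero hα two_ne_zero), Real.rpow_one]

lemma lintegral_gain_bsCost (hα : 0 < α) (hκ : 0 ≤ κ) {x : Plane} (hx : x ≠ 0) {p : ℝ}
    (hp : 0 < p) :
    ∫⁻ h, 1 - expNeg (bsCost α κ t (x, (h, p))) ∂expMeasure 1
      = if ‖x‖ ^ 2 / p ^ (2 / α) ≤ t then 1
        else ENNReal.ofReal (fadingLoss (α / 2) κ (‖x‖ ^ 2 / p ^ (2 / α))) := by
  have hx' : 0 < ‖x‖ := norm_pos_iff.2 hx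
  split_ifs with hw
  · simp [bsCost, hw]
  have hcost : ∀ h, bsCost α κ t (x, (h, p))
      = ENNReal.ofReal (κ * (‖x‖ ^ 2 / p ^ (2 / α)) ^ (-(α / 2)) * h) := fun h => by
    rw [Real.rpow_neg (by positivity), sq_div_rpow_rpow hα.ne' hx'.le hp.le, inv_div,
      div_eq_mul_inv, ← Real.rpow_neg hx'.le, bsCost, if_neg hw, zero_add]
    congr 1
    ring
  simp_rw [hcost]
  rw [lintegral_one_sub_expNeg (by fun_prop), lintegral_expNeg_gain _ hκ (by positivity),
    ← ENNReal.ofReal_one, ← ENNReal.ofReal_sub _ (sub_nonneg.2 (fadingLoss_le_one _ _ hκ)),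
    sub_sub_cancel]

lemma lintegral_bsCost (hα : 2 < α) (hκ : 0 ≤ κ) (ht : 0 ≤ t) {τ : Measure ℝ}
    [IsProbabilityMeasure τ] (hτ : ∀ᵐ p ∂τ, 0 < p) {M : ℝ}
    (hM : ∫⁻ p, ENNReal.ofReal (p ^ (2 / α)) ∂τ = ENNReal.ofReal M) :
    ∫⁻ x, ∫⁻ e, 1 - expNeg (bsCost α κ t (x, e)) ∂((expMeasure 1).prod τ)
      = ENNReal.ofReal (Real.pi * M * lossIntegral (α / 2) κ t) := by
  let φ : ℝ → ℝ≥0∞ := fun w => if w ≤ t then 1 else ENNReal.ofReal (fadingLoss (α / 2) κ w)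
  have hφ : Measurable φ :=
    Measurable.ite (measurableSet_le measurable_id measurable_const) measurable_const (by fun_prop)
  have hgain : ∀ᵐ x : Plane, ∫⁻ e, 1 - expNeg (bsCost α κ t (x, e)) ∂((expMeasure 1).prod τ)
      = ∫⁻ p, φ (‖x‖ ^ 2 / p ^ (2 / α)) ∂τ := by
    have hne : ∀ᵐ x : Plane, x ≠ 0 := by simp [ae_iff]
    filter_upwards [hne] with x hx
    rw [lintegral_prod_symm' _ (by fun_prop)]
    exact lintegral_congr_ae (hτ.mono fun p hp => lintegral_gain_bsCost (by linarith) hκ hx hp)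
  have hradial : ∀ᵐ p ∂τ, ∫⁻ x : Plane, φ (‖x‖ ^ 2 / p ^ (2 / α))
      = ENNReal.ofReal (p ^ (2 / α)) * (ENNReal.ofReal Real.pi * ∫⁻ u in Ioi (0 : ℝ), φ u) := by
    filter_upwards [hτ] with p hp
    rw [lintegral_norm_sq_div hφ (Real.rpow_pos_of_pos hp _), mul_left_comm]
  have hloss : 0 ≤ lossIntegral (α / 2) κ t := ht.trans (le_lossIntegral (α / 2) t hκ)
  rw [lintegral_congr_ae hgain, lintegral_lintegral_swap (by fun_prop), lintegral_congr_ae hradial,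
    lintegral_mul_const _ (by fun_prop), hM, setLIntegral_ite_fadingLoss (by linarith) hκ ht,
    mul_comm Real.pi, mul_assoc,
    ENNReal.ofReal_mul' (mul_nonneg Real.pi_nonneg hloss),
    ENNReal.ofReal_mul Real.pi_nonneg]

end BaseStationCost

/-! ### The transmit power of a buyer -/

/-- The rate of the exponential law of `H ^ (-2/α)`, where `H` is the largest gain to a Poisson
process of users of intensity `r`. -/
def largestGainRate (α : ℝ) (r : ℝ≥0) : ℝ := r * (Real.pi * Real.Gamma (1 / (α / 2) + 1))

lemma largestGainRate_pos {α : ℝ} (hα : 0 < α) {r : ℝ≥0} (hr : 0 < r) :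
    0 < largestGainRate α r := by
  have := Real.Gamma_pos_of_pos (s := 1 / (α / 2) + 1) (by positivity)
  have := Real.pi_pos
  unfold largestGainRate
  positivity

lemma largestGainRate_nonneg {α : ℝ} (hα : 0 < α) (r : ℝ≥0) : 0 ≤ largestGainRate α r := by
  have := Real.Gamma_nonneg_of_nonneg (s := 1 / (α / 2) + 1) (by positivity)
  have := Real.pi_pos
  unfold largestGainRate
  positivity

lemma expMeasure_gain_gt {α d u : ℝ} (hα : α ≠ 0) (hd : 0 < d) (hu : 0 < u) :
    expMeasure 1 {e | ENNReal.ofReal (u ^ (-(α / 2))) < ENNReal.ofReal (e * d ^ (-α))}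
      = ENNReal.ofReal (Real.exp (-(d ^ 2 / u) ^ (α / 2))) := by
  have hlevel : (d ^ 2 / u) ^ (α / 2) = u ^ (-(α / 2)) * d ^ α := by
    have hsq : (d ^ 2 / 1 ^ (2 / α)) ^ (α / 2) = d ^ α / 1 := sq_div_rpow_rpow hα hd.le zero_le_one
    rw [Real.one_rpow, div_one, div_one] at hsq
    rw [Real.div_rpow (by positivity) hu.le, hsq, Real.rpow_neg hu.le, div_eq_inv_mul]
  have hset : {e : ℝ | ENNReal.ofReal (u ^ (-(α / 2))) < ENNReal.ofReal (e * d ^ (-α))}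
      = {e | ENNReal.ofReal ((d ^ 2 / u) ^ (α / 2)) < ENNReal.ofReal e} := by
    ext e
    rw [mem_ofPred_eq, mem_ofPred_eq, ENNReal.ofReal_lt_ofReal_iff_of_nonneg (by positivity),
      ENNReal.ofReal_lt_ofReal_iff_of_nonneg (by positivity), hlevel, Real.rpow_neg hd.le,
      ← div_eq_mul_inv, lt_div_iff₀ (by positivity)]
  rw [hset, expMeasure_lt_ofReal, expNeg_ofReal (by positivity)]

lemma lintegral_Ioi_exp_neg_rpow {p : ℝ} (hp : 0 < p) :
    ∫⁻ v in Ioi (0 : ℝ), ENNReal.ofReal (Real.exp (-v ^ p))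
      = ENNReal.ofReal (Real.Gamma (1 / p + 1)) := by
  have hpos : 0 < Real.Gamma (1 / p + 1) := Real.Gamma_pos_of_pos (by positivity)
  have hvalue := integral_exp_neg_rpow hp
  rw [← hvalue, ofReal_integral_eq_lintegral_ofReal _ (.of_forall fun v => Real.exp_nonneg _)]
  exact not_imp_comm.1 integral_undef (hvalue ▸ hpos.ne')

namespace IsUserField

variable {Ω : Type*} [MeasurableSpace Ω] {Y : ℕ → Ω → Plane} {g : ℕ → Ω → ℝ} {r : ℝ≥0}
  {P : Measure Ω}

lemma isMarkedPoisson [IsProbabilityMeasure P] (h : IsUserField Y g r P) :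
    IsMarkedPoisson (fun _ : Unit => Y) (fun _ => g) (fun _ => r) (fun _ => expMeasure 1) P where
  poisson _ := h.poisson
  indep := iIndepFun.of_subsingleton
  mark_measurable _ := h.gain_measurable
  mark_law _ n := (h.gain_law n).map_eq
  mark_indep := h.gain_indep.precomp (g := Prod.snd) fun i j hij => Prod.ext rfl hij
  indep_mark := h.indep.comp (φ := fun (y : ℕ → Plane) (i : Unit × ℕ) => y i.2)
    (ψ := fun (y : ℕ → ℝ) (i : Unit × ℕ) => y i.2) (by fun_prop) (by fun_prop)

lemma measurable_largestGain (h : IsUserField Y g r P) (α : ℝ) (x : Plane) :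
    Measurable (largestGain α x Y g) := by
  have := h.poisson.measurable
  have := h.gain_measurable
  unfold largestGain
  fun_prop

lemma measurable_maxPower (h : IsUserField Y g r P) (α ζ : ℝ) (x : Plane) :
    Measurable (maxPower α ζ x Y g) := by
  have := h.measurable_largestGain α x
  unfold maxPower
  fun_prop

lemma integrable_rpow_map_maxPower_iff (h : IsUserField Y g r P) (α ζ : ℝ) (x : Plane) (s : ℝ) :
    Integrable (fun p => p ^ s) (P.map (maxPower α ζ x Y g))
      ↔ Integrable (fun ω => maxPower α ζ x Y g ω ^ s) P :=
  integrable_map_measure (by fun_prop) (h.measurable_maxPower α ζ x).aemeasurable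

lemma integral_rpow_map_maxPower (h : IsUserField Y g r P) (α ζ : ℝ) (x : Plane) (s : ℝ) :
    ∫ p, p ^ s ∂P.map (maxPower α ζ x Y g) = ∫ ω, maxPower α ζ x Y g ω ^ s ∂P :=
  integral_map (h.measurable_maxPower α ζ x).aemeasurable (by fun_prop)

variable [IsProbabilityMeasure P] {α : ℝ}

lemma measure_largestGain_le (h : IsUserField Y g r P) (hα : 0 < α) (x : Plane) {u : ℝ}
    (hu : 0 < u) :
    P {ω | largestGain α x Y g ω ≤ ENNReal.ofReal (u ^ (-(α / 2)))}
      = expNeg (ENNReal.ofReal (largestGainRate α r * u)) := by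
  let A : Set (Plane × ℝ) :=
    {q | ENNReal.ofReal (u ^ (-(α / 2))) < ENNReal.ofReal (q.2 * ‖x - q.1‖ ^ (-α))}
  have hA : MeasurableSet A := measurableSet_lt measurable_const (by fun_prop)
  have hevent : {ω | largestGain α x Y g ω ≤ ENNReal.ofReal (u ^ (-(α / 2)))}
      = {ω | ∀ n, (Y n ω, g n ω) ∉ A} := by
    simp only [largestGain, iSup_le_iff, A, mem_ofPred_eq, not_lt]
  have hslice : ∀ᵐ y : Plane, expMeasure 1 (Prod.mk y ⁻¹' A)
      = ENNReal.ofReal (Real.exp (-(‖x - y‖ ^ 2 / u) ^ (α / 2))) := by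
    have hne : ∀ᵐ y : Plane, y ≠ x := by simp [ae_iff]
    filter_upwards [hne] with y hy
    have hdist : 0 < ‖x - y‖ := norm_pos_iff.2 (sub_ne_zero.2 hy.symm)
    rw [← expMeasure_gain_gt hα.ne' hdist hu]
    rfl
  have hA_volume : (volume.prod (expMeasure 1)) A
      = ENNReal.ofReal (Real.pi * Real.Gamma (1 / (α / 2) + 1) * u) := by
    rw [Measure.prod_apply hA, lintegral_congr_ae hslice, lintegral_sub_left_eq_self
        (fun y : Plane => ENNReal.ofReal (Real.exp (-(‖y‖ ^ 2 / u) ^ (α / 2)))) x,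
      lintegral_norm_sq_div (φ := fun v => ENNReal.ofReal (Real.exp (-v ^ (α / 2))))
        (by fun_prop) hu, lintegral_Ioi_exp_neg_rpow (by positivity),
      ← ENNReal.ofReal_mul hu.le, ← ENNReal.ofReal_mul Real.pi_nonneg]
    congr 1
    ring
  rw [hevent, h.isMarkedPoisson.measure_forall_notMem () hA, hA_volume,
    ← ENNReal.ofReal_coe_nnreal, ← ENNReal.ofReal_mul r.coe_nonneg, ← mul_assoc, largestGainRate]

lemma ae_largestGain_ne_zero (h : IsUserField Y g r P) (hr : 0 < r) (hα : 0 < α) (x : Plane) :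
    ∀ᵐ ω ∂P, largestGain α x Y g ω ≠ 0 := by
  have hlim : Filter.Tendsto (fun u : ℝ => expNeg (ENNReal.ofReal (largestGainRate α r * u)))
      Filter.atTop (nhds 0) := by
    rw [← expNeg_top]
    exact (continuous_expNeg.tendsto _).comp (ENNReal.tendsto_ofReal_atTop.comp
      (Filter.tendsto_id.const_mul_atTop (largestGainRate_pos hα hr)))
  rw [ae_iff]
  refine le_antisymm (ge_of_tendsto hlim ?_) zero_le
  filter_upwards [Filter.eventually_gt_atTop 0] with u hu
  rw [← h.measure_largestGain_le hα x hu]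
  exact measure_mono fun ω hω => (not_not.1 hω).trans_le zero_le

lemma ae_largestGain_ne_top (h : IsUserField Y g r P) (hα : 0 < α) (x : Plane) :
    ∀ᵐ ω ∂P, largestGain α x Y g ω ≠ ∞ := by
  have hlim : Filter.Tendsto (fun u : ℝ => expNeg (ENNReal.ofReal (largestGainRate α r * u)))
      (nhdsWithin 0 (Ioi 0)) (nhds 1) := by
    have hcont : Continuous fun u : ℝ => expNeg (ENNReal.ofReal (largestGainRate α r * u)) :=
      continuous_expNeg.comp (ENNReal.continuous_ofReal.comp (by fun_prop))
    simpa using (hcont.tendsto 0).mono_left nhdsWithin_le_nhds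
  refine (prob_compl_eq_zero_iff
    ((h.measurable_largestGain α x) (measurableSet_singleton ∞)).compl).2 ?_
  refine le_antisymm prob_le_one (le_of_tendsto hlim ?_)
  filter_upwards [self_mem_nhdsWithin] with u hu
  rw [← h.measure_largestGain_le hα x hu]
  exact measure_mono fun ω (hω : largestGain α x Y g ω ≤ _) =>
    (hω.trans_lt ENNReal.ofReal_lt_top).ne

lemma ae_map_maxPower_pos (h : IsUserField Y g r P) (hr : 0 < r) (hα : 0 < α) (x : Plane)
    {ζ : ℝ} (hζ : 0 < ζ) : ∀ᵐ p ∂P.map (maxPower α ζ x Y g), 0 < p := by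
  refine (ae_map_iff (h.measurable_maxPower α ζ x).aemeasurable measurableSet_Ioi).2 ?_
  filter_upwards [h.ae_largestGain_ne_zero hr hα x, h.ae_largestGain_ne_top hα x] with ω hω₀ hω
  exact ENNReal.toReal_pos (ENNReal.div_pos (by simpa using hζ) hω).ne'
    (ENNReal.div_ne_top ENNReal.ofReal_ne_top hω₀)

lemma measure_le_maxPower_rpow_le (h : IsUserField Y g r P) (hα : 0 < α) (x : Plane)
    {ζ : ℝ} (hζ : 0 < ζ) {t : ℝ} (ht : 0 < t) :
    P {ω | t ≤ maxPower α ζ x Y g ω ^ (2 / α)}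
      ≤ ENNReal.ofReal (Real.exp (-(largestGainRate α r * ζ ^ (-(2 / α))) * t)) := by
  have hlevel : (ζ ^ (-(2 / α)) * t) ^ (-(α / 2)) = ζ / t ^ (α / 2) := by
    have hexp : -(2 / α) * -(α / 2) = 1 := by field_simp
    rw [Real.mul_rpow (by positivity) ht.le, ← Real.rpow_mul hζ.le, Real.rpow_neg ht.le, hexp,
      Real.rpow_one, ← div_eq_mul_inv]
  have htail := h.measure_largestGain_le hα x (u := ζ ^ (-(2 / α)) * t) (by positivity)
  have hrate := largestGainRate_nonneg hα r
  rw [hlevel, expNeg_ofReal (by positivity), ← mul_assoc, ← neg_mul] at htail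
  rw [← htail]
  refine measure_mono fun ω (hω : t ≤ maxPower α ζ x Y g ω ^ (2 / α)) => ?_
  have hpower : t ^ (α / 2) ≤ maxPower α ζ x Y g ω :=
    calc t ^ (α / 2) ≤ (maxPower α ζ x Y g ω ^ (2 / α)) ^ (α / 2) :=
          Real.rpow_le_rpow ht.le hω (by positivity)
      _ = maxPower α ζ x Y g ω := by
          have hexp : 2 / α * (α / 2) = 1 := by field_simp
          rw [← Real.rpow_mul (x := maxPower α ζ x Y g ω) ENNReal.toReal_nonneg, hexp,
            Real.rpow_one]
  have hdiv : ENNReal.ofReal (t ^ (α / 2)) ≤ ENNReal.ofReal ζ / largestGain α x Y g ω :=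
    (ENNReal.ofReal_le_ofReal hpower).trans ENNReal.ofReal_toReal_le
  have htpos : 0 < t ^ (α / 2) := Real.rpow_pos_of_pos ht _
  rw [mem_ofPred_eq, ENNReal.ofReal_div_of_pos htpos, ENNReal.le_div_iff_mul_le
    (.inl (by simpa using htpos)) (.inl ENNReal.ofReal_ne_top), mul_comm]
  exact ENNReal.mul_le_of_le_div hdiv

lemma integrable_maxPower_rpow (h : IsUserField Y g r P) (hr : 0 < r) (hα : 0 < α) (x : Plane)
    {ζ : ℝ} (hζ : 0 < ζ) :
    Integrable (fun ω => maxPower α ζ x Y g ω ^ (2 / α)) P := by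
  have hmeas : Measurable fun ω => maxPower α ζ x Y g ω ^ (2 / α) :=
    (h.measurable_maxPower α ζ x).pow_const _
  have hnonneg : ∀ ω, 0 ≤ maxPower α ζ x Y g ω ^ (2 / α) := fun ω =>
    Real.rpow_nonneg ENNReal.toReal_nonneg _
  have hrate : 0 < largestGainRate α r * ζ ^ (-(2 / α)) :=
    mul_pos (largestGainRate_pos hα hr) (Real.rpow_pos_of_pos hζ _)
  refine ⟨hmeas.aestronglyMeasurable, ?_⟩
  rw [hasFiniteIntegral_iff_ofReal (.of_forall hnonneg),
    lintegral_eq_lintegral_meas_le P (.of_forall hnonneg) hmeas.aemeasurable]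
  refine (setLIntegral_mono (by fun_prop)
    fun t ht => h.measure_le_maxPower_rpow_le hα x hζ ht).trans_lt ?_
  exact (hasFiniteIntegral_iff_ofReal (.of_forall fun _ => Real.exp_nonneg _)).1
    (integrableOn_exp_mul_Ioi (neg_lt_zero.2 hrate) 0).2

end IsUserField

/-! ### The base stations of all operators -/

lemma measurable_nat_sInf {Ω : Type*} [MeasurableSpace Ω] {S : Ω → Set ℕ}
    (hS : ∀ j, MeasurableSet {ω | j ∈ S ω}) : Measurable fun ω => sInf (S ω) := by
  refine measurable_of_Ioi fun n => ?_
  have hlt : (fun ω => sInf (S ω)) ⁻¹' Ioi n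
      = (⋃ j, {ω | j ∈ S ω}) ∩ ⋂ j ∈ Iic n, {ω | j ∈ S ω}ᶜ := by
    ext ω
    simp only [mem_preimage, mem_Ioi, mem_inter_iff, mem_iUnion, mem_iInter, mem_ofPred_eq,
      mem_compl_iff, mem_Iic]
    constructor
    · intro h
      exact ⟨Nat.nonempty_of_pos_sInf (n.zero_le.trans_lt h),
        fun j hj hmem => (hj.trans_lt h).not_ge (Nat.sInf_le hmem)⟩
    · rintro ⟨hne, hnot⟩
      exact not_le.1 fun hle => hnot _ hle (Nat.sInf_mem hne)
  rw [hlt]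
  exact (MeasurableSet.iUnion hS).inter
    (MeasurableSet.biInter (to_countable _) fun j _ => (hS j).compl)

namespace Downlink

section Measurability

variable {O Ω : Type*} (D : Downlink O Ω)

/-- The variable `x² / P ^ (2/α)` of the `n`-th base station of buyer `k`; the serving base station
is the one that minimizes it. -/
def pathLoss (k : O) (n : ℕ) (ω : Ω) : ℝ := ‖D.bs k n ω‖ ^ 2 / D.power k n ω ^ (2 / D.α)

/-- Interference at the user of `b` if it were served by the `n`-th base station of `b`. -/
def interferenceFrom [DecidableEq O] (b : O) (n : ℕ) (ω : Ω) : ℝ≥0∞ :=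
  (∑' m : ℕ, if m = n then 0 else D.received b m ω)
    + (∑' m : ℕ, ENNReal.ofReal
        (D.sellerPower * D.gain D.seller m ω * ‖D.bs D.seller m ω‖ ^ (-D.α)))
    + ∑ k ∈ D.group \ {D.seller, b}, ∑' m : ℕ, D.received k m ω

variable {D} {mΩ : MeasurableSpace Ω} {b : O}

lemma measurable_serving (hbs : ∀ n, Measurable (D.bs b n))
    (hp : ∀ n, Measurable (D.power b n)) : Measurable (D.serving b) := by
  have hr : ∀ m, Measurable (D.meanReceived b m) := fun m => by
    have := hbs m
    have := hp m
    unfold meanReceived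
    fun_prop
  refine measurable_nat_sInf fun j => ?_
  change MeasurableSet {ω | ∀ m, D.meanReceived b m ω ≤ D.meanReceived b j ω}
  rw [ofPred_forall]
  exact MeasurableSet.iInter fun m => measurableSet_le (hr m) (hr j)

lemma measurable_pathLoss {n : ℕ} (hbs : Measurable (D.bs b n)) (hp : Measurable (D.power b n)) :
    Measurable (D.pathLoss b n) := by
  unfold pathLoss
  fun_prop

lemma measurable_received {k : O} {n : ℕ} (hbs : Measurable (D.bs k n))
    (hp : Measurable (D.power k n)) (hg : Measurable (D.gain k n)) :
    Measurable (D.received k n) := by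
  unfold received
  fun_prop

variable [DecidableEq O]

lemma measurable_interferenceFrom {n : ℕ} (hseller : D.seller ∈ D.group) (hbuyer : b ∈ D.group)
    (hne : b ≠ D.seller) (hbs : ∀ k ∈ D.group, ∀ m, Measurable (D.bs k m))
    (hp : ∀ k ∈ D.group.erase D.seller, ∀ m, Measurable (D.power k m))
    (hg : ∀ k ∈ D.group, ∀ m, (k = b → m ≠ n) → Measurable (D.gain k m)) :
    Measurable (D.interferenceFrom b n) := by
  have hrec : ∀ k ∈ D.group.erase D.seller, ∀ m, (k = b → m ≠ n) → Measurable (D.received k m) :=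
    fun k hk m hkm => measurable_received (hbs k (Finset.mem_of_mem_erase hk) m) (hp k hk m)
      (hg k (Finset.mem_of_mem_erase hk) m hkm)
  refine (Measurable.add (Measurable.tsum fun m => ?_) (Measurable.tsum fun m => ?_)).add
    (Finset.measurable_fun_sum _ fun k hk => Measurable.tsum fun m => ?_)
  · by_cases hm : m = n
    · simp [hm]
    · simpa [hm] using hrec b (Finset.mem_erase.2 ⟨hne, hbuyer⟩) m fun _ => hm
  · have := hbs _ hseller m
    have := hg _ hseller m fun h => absurd h.symm hne
    fun_prop
  · simp only [Finset.mem_sdiff, Finset.mem_insert, Finset.mem_singleton, not_or] at hk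
    exact hrec k (Finset.mem_erase.2 ⟨hk.2.1, hk.1⟩) m fun h => absurd h hk.2.2

end Measurability

section Marks

variable {O Ω : Type*} [DecidableEq O] (D : Downlink O Ω)

/-- Transmit power of the `n`-th base station of operator `k`, be it the seller or a buyer. -/
def txPower (k : O) (n : ℕ) (ω : Ω) : ℝ := if k = D.seller then D.sellerPower else D.power k n ω

/-- Law of the transmit power of the base stations of operator `k`. -/
def txLaw (powerLaw : Measure ℝ) (k : O) : Measure ℝ :=
  if k = D.seller then Measure.dirac D.sellerPower else powerLaw

/-- Moment of order `2/α` of the transmit power of the base stations of operator `k`, where `M` is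
that of a buyer. -/
def txMoment (M : ℝ) (k : O) : ℝ := if k = D.seller then D.sellerPower ^ (2 / D.α) else M

/-- The mark of the `n`-th base station of operator `k`: its gain and its transmit power. -/
def mark (k : O) (n : ℕ) (ω : Ω) : ℝ × ℝ := (D.gain k n ω, D.txPower k n ω)

lemma exists_measurable_txPower :
    ∃ Φ : ({k // k ∈ D.group.erase D.seller} × ℕ → ℝ) → (D.group × ℕ) → ℝ, Measurable Φ ∧
      ∀ ω, Φ (fun i => D.power i.1 i.2 ω) = fun i => D.txPower i.1 i.2 ω := by
  refine ⟨fun v i => if h : i.1.1 = D.seller then D.sellerPower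
    else v (⟨i.1.1, Finset.mem_erase.2 ⟨h, i.1.2⟩⟩, i.2), ?_, fun ω => ?_⟩
  · refine measurable_pi_lambda _ fun i => ?_
    by_cases h : i.1.1 = D.seller
    · simp [h]
    · simp only [h, dite_false]
      fun_prop
  · ext i
    by_cases h : i.1.1 = D.seller <;> simp [h, txPower]

namespace IsModel

variable {D} [MeasurableSpace Ω] {P : Measure Ω} {powerLaw : Measure ℝ}

lemma measurable_txPower (hD : D.IsModel powerLaw P) {k : O} (hk : k ∈ D.group) (n : ℕ) :
    Measurable (D.txPower k n) := by
  unfold txPower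
  by_cases h : k = D.seller
  · simp [h]
  · simpa [h] using hD.power_measurable k (Finset.mem_erase.2 ⟨h, hk⟩) n

lemma measurable_mark (hD : D.IsModel powerLaw P) {k : O} (hk : k ∈ D.group) (n : ℕ) :
    Measurable (D.mark k n) :=
  (hD.gain_measurable k hk n).prodMk (hD.measurable_txPower hk n)

lemma indepFun_gain_txPower (hD : D.IsModel powerLaw P) :
    IndepFun (fun ω (i : D.group × ℕ) => D.gain i.1 i.2 ω)
      (fun ω (i : D.group × ℕ) => D.txPower i.1 i.2 ω) P := by
  obtain ⟨Φ, hΦm, hΦ⟩ := D.exists_measurable_txPower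
  rw [← funext hΦ]
  exact hD.gain_power_indep.comp measurable_id hΦm

lemma indepFun_bs_mark (hD : D.IsModel powerLaw P) :
    IndepFun (fun ω (i : D.group × ℕ) => D.bs i.1 i.2 ω)
      (fun ω (i : D.group × ℕ) => D.mark i.1 i.2 ω) P := by
  obtain ⟨Φ, hΦm, hΦ⟩ := D.exists_measurable_txPower
  have hmark : (fun ω (i : D.group × ℕ) => D.mark i.1 i.2 ω)
      = fun ω i => (D.gain i.1 i.2 ω, Φ (fun i => D.power i.1 i.2 ω) i) := by
    funext ω i
    rw [hΦ, mark]
  rw [hmark]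
  exact hD.bs_marks_indep.comp (φ := id) (ψ := fun (q : (D.group × ℕ → ℝ) ×
    ({k // k ∈ D.group.erase D.seller} × ℕ → ℝ)) i => (q.1 i, Φ q.2 i)) measurable_id (by fun_prop)

variable [IsProbabilityMeasure P]

lemma map_txPower (hD : D.IsModel powerLaw P) {k : O} (hk : k ∈ D.group) (n : ℕ) :
    P.map (D.txPower k n) = D.txLaw powerLaw k := by
  unfold txPower txLaw
  by_cases h : k = D.seller
  · simp [h, Measure.map_const]
  · simpa [h] using (hD.power_law k (Finset.mem_erase.2 ⟨h, hk⟩) n).map_eq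

lemma map_mark (hD : D.IsModel powerLaw P) {k : O} (hk : k ∈ D.group) (n : ℕ) :
    P.map (D.mark k n) = (expMeasure 1).prod (D.txLaw powerLaw k) := by
  have hi : IndepFun (D.gain k n) (D.txPower k n) P := hD.indepFun_gain_txPower.comp
    (measurable_pi_apply ((⟨k, hk⟩, n) : D.group × ℕ))
    (measurable_pi_apply ((⟨k, hk⟩, n) : D.group × ℕ))
  rw [← hD.map_txPower hk n, ← (hD.gain_law k hk n).map_eq]
  exact hi.map_prod_eq_prod_map_map (hD.gain_measurable k hk n).aemeasurable
    (hD.measurable_txPower hk n).aemeasurable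

lemma iIndepFun_txPower (hD : D.IsModel powerLaw P) :
    iIndepFun (fun i : D.group × ℕ => D.txPower i.1 i.2) P := by
  refine iIndepFun_of_const_off_range
    (e := fun j : {k // k ∈ D.group.erase D.seller} × ℕ =>
      ((⟨j.1.1, Finset.mem_of_mem_erase j.1.2⟩ : D.group), j.2)) ?_ ?_ ?_
  · rintro ⟨⟨i, hi⟩, n⟩ ⟨⟨j, hj⟩, m⟩ h
    simpa only [Prod.mk.injEq, Subtype.mk.injEq] using h
  · convert hD.power_indep using 2 with j
    ext ω
    simp [txPower, Finset.ne_of_mem_erase j.1.2]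
  · rintro ⟨⟨k, hk⟩, n⟩ hi
    have hk' : k = D.seller := by
      by_contra hne
      exact hi ⟨(⟨k, Finset.mem_erase.2 ⟨hne, hk⟩⟩, n), rfl⟩
    exact ⟨D.sellerPower, funext fun ω => if_pos hk'⟩

lemma isMarkedPoisson (hD : D.IsModel powerLaw P) :
    IsMarkedPoisson (fun k : D.group => D.bs k) (fun k : D.group => D.mark k)
      (fun k => D.intensity k) (fun k => (expMeasure 1).prod (D.txLaw powerLaw k)) P where
  poisson k := hD.bs_poisson k k.2
  indep := hD.bs_indep
  mark_measurable k n := hD.measurable_mark k.2 n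
  mark_law k n := hD.map_mark k.2 n
  mark_indep := iIndepFun_prodMk_of_indepFun (u := fun i : D.group × ℕ => D.gain i.1 i.2)
    (fun i => hD.gain_measurable i.1 i.1.2 i.2) (fun i => hD.measurable_txPower i.1.2 i.2)
    hD.gain_indep hD.iIndepFun_txPower hD.indepFun_gain_txPower
  indep_mark := hD.indepFun_bs_mark

end IsModel

end Marks

section ServingGain

variable {O Ω : Type*} [DecidableEq O]

/-- All gains but the one with index `i`, the powers and the positions of the base stations. -/
def dataExceptGain (D : Downlink O Ω) (i : D.group × ℕ) (ω : Ω) :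
    (({j // j ≠ i} → ℝ) × ({k // k ∈ D.group.erase D.seller} × ℕ → ℝ)) × (D.group × ℕ → Plane) :=
  ((fun j => D.gain j.1.1 j.1.2 ω, fun j => D.power j.1 j.2 ω), fun j => D.bs j.1 j.2 ω)

variable [MeasurableSpace Ω]

namespace IsModel

variable {D : Downlink O Ω} {P : Measure Ω} {powerLaw : Measure ℝ}

lemma measurable_dataExceptGain (hD : D.IsModel powerLaw P) (i : D.group × ℕ) :
    Measurable (D.dataExceptGain i) := by
  have hg := fun k : D.group => hD.gain_measurable k k.2
  have hp := fun k : {k // k ∈ D.group.erase D.seller} => hD.power_measurable k k.2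
  have hb := fun k : D.group => (hD.bs_poisson k k.2).measurable
  exact ((measurable_pi_lambda _ fun j : {j // j ≠ i} => hg j.1.1 j.1.2).prodMk
    (measurable_pi_lambda _ fun j : {k // k ∈ D.group.erase D.seller} × ℕ => hp j.1 j.2)).prodMk
    (measurable_pi_lambda _ fun j : D.group × ℕ => hb j.1 j.2)

lemma indepFun_gain_dataExceptGain [IsProbabilityMeasure P] (hD : D.IsModel powerLaw P)
    (i : D.group × ℕ) :
    IndepFun (D.gain i.1 i.2) (D.dataExceptGain i) P := by
  have hg : ∀ j : D.group × ℕ, Measurable (D.gain j.1 j.2) := fun j =>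
    hD.gain_measurable j.1 j.1.2 j.2
  have hV := hD.measurable_dataExceptGain i
  have hgains : IndepFun (D.gain i.1 i.2)
      (fun ω (j : {j // j ≠ i}) => D.gain j.1.1 j.1.2 ω) P :=
    indepFun_restrict_ne hg hD.gain_indep i
  have hpowers := hD.gain_power_indep.comp (ψ := id)
    (φ := fun v : D.group × ℕ → ℝ => (v i, fun j : {j // j ≠ i} => v j.1))
    (by fun_prop) measurable_id
  have hpositions := hD.bs_marks_indep.symm.comp (ψ := id)
    (φ := fun q : (D.group × ℕ → ℝ) × ({k // k ∈ D.group.erase D.seller} × ℕ → ℝ) =>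
      (q.1 i, ((fun j : {j // j ≠ i} => q.1 j.1), q.2))) (by fun_prop) measurable_id
  exact indepFun_prodMk_right_of_prodMk_left (hg i) hV.fst hV.snd
    (indepFun_prodMk_right_of_prodMk_left (hg i) hV.fst.fst hV.fst.snd hgains hpowers) hpositions

end IsModel

/-- The model of a buyer `b` together with what the coverage formula assumes of the parameters;
`powerLaw` is the law of the transmit power of a base station of a buyer and `M` its moment of
order `2/α`. -/
structure IsRegular (D : Downlink O Ω) (b : O) (powerLaw : Measure ℝ) (M : ℝ) (P : Measure Ω) :
    Prop where
  model : D.IsModel powerLaw P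
  seller_mem : D.seller ∈ D.group
  buyer_mem : b ∈ D.group
  buyer_ne : b ≠ D.seller
  intensity_pos : 0 < D.intensity b
  two_lt : 2 < D.α
  sellerPower_pos : 0 < D.sellerPower
  ae_pos : ∀ᵐ p ∂powerLaw, 0 < p
  integrable : Integrable (fun p => p ^ (2 / D.α)) powerLaw
  moment_eq : M = ∫ p, p ^ (2 / D.α) ∂powerLaw

namespace IsRegular

variable {D : Downlink O Ω} {b : O} {P : Measure Ω} {powerLaw : Measure ℝ} {M : ℝ}

lemma measurable_bs (S : D.IsRegular b powerLaw M P) {k : O} (hk : k ∈ D.group) (n : ℕ) :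
    Measurable (D.bs k n) := (S.model.bs_poisson k hk).measurable n

lemma buyer_mem_erase (S : D.IsRegular b powerLaw M P) : b ∈ D.group.erase D.seller :=
  Finset.mem_erase.2 ⟨S.buyer_ne, S.buyer_mem⟩

lemma measurable_power (S : D.IsRegular b powerLaw M P) (n : ℕ) : Measurable (D.power b n) :=
  S.model.power_measurable b S.buyer_mem_erase n

lemma measurable_serving (S : D.IsRegular b powerLaw M P) : Measurable (D.serving b) :=
  Downlink.measurable_serving (S.measurable_bs S.buyer_mem) S.measurable_power

lemma measurable_servingZ (S : D.IsRegular b powerLaw M P) : Measurable (D.servingZ b) :=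
  measurable_apply_of_countable (F := D.pathLoss b) S.measurable_serving fun n =>
    measurable_pathLoss (S.measurable_bs S.buyer_mem n) (S.measurable_power n)

lemma measurable_interference (S : D.IsRegular b powerLaw M P) : Measurable (D.interference b) :=
  measurable_apply_of_countable (F := D.interferenceFrom b) S.measurable_serving fun _ =>
    measurable_interferenceFrom S.seller_mem S.buyer_mem S.buyer_ne
      (fun _ hk => S.measurable_bs hk) S.model.power_measurable
      fun k hk m _ => S.model.gain_measurable k hk m

lemma lintegral_serving_gain [IsProbabilityMeasure P] (S : D.IsRegular b powerLaw M P)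
    {g : ℝ × (ℝ × ℝ≥0∞) → ℝ≥0∞} (hg : Measurable g) :
    ∫⁻ ω, g (D.gain b (D.serving b ω) ω, (D.servingZ b ω, D.interference b ω)) ∂P
      = ∫⁻ ω, ∫⁻ x, g (x, (D.servingZ b ω, D.interference b ω)) ∂(expMeasure 1) ∂P := by
  let idx : ℕ → D.group × ℕ := fun n => (⟨b, S.buyer_mem⟩, n)
  let 𝓖 : ℕ → MeasurableSpace Ω := fun n =>
    MeasurableSpace.comap (D.dataExceptGain (idx n)) inferInstance
  have hV : ∀ n, Measurable[𝓖 n] (D.dataExceptGain (idx n)) := fun n => comap_measurable _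
  have hbs : ∀ n, ∀ k ∈ D.group, ∀ m, Measurable[𝓖 n] (D.bs k m) := fun n k hk m =>
    (measurable_pi_apply ((⟨k, hk⟩, m) : D.group × ℕ)).comp (hV n).snd
  have hp : ∀ n, ∀ k ∈ D.group.erase D.seller, ∀ m, Measurable[𝓖 n] (D.power k m) :=
    fun n k hk m => (measurable_pi_apply
      ((⟨k, hk⟩, m) : {k // k ∈ D.group.erase D.seller} × ℕ)).comp (hV n).fst.snd
  have hgain : ∀ n, ∀ k ∈ D.group, ∀ m, (k = b → m ≠ n) → Measurable[𝓖 n] (D.gain k m) :=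
    fun n k hk m hkm => by
      have hne : ((⟨k, hk⟩, m) : D.group × ℕ) ≠ idx n := fun h =>
        hkm (congrArg (fun i => (i.1 : O)) h) (congrArg Prod.snd h)
      exact (measurable_pi_apply (⟨_, hne⟩ : {j // j ≠ idx n})).comp (hV n).fst.fst
  exact lintegral_comp_selected (𝓖 := 𝓖) (N := D.serving b)
    (V := fun n ω => (D.pathLoss b n ω, D.interferenceFrom b n ω))
    (fun n => (S.model.measurable_dataExceptGain (idx n)).comap_le)
    (S.model.gain_measurable b S.buyer_mem)
    (fun n => (S.model.gain_law b S.buyer_mem n).map_eq)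
    (fun n => (IndepFun_iff_Indep _ _ _).1 (S.model.indepFun_gain_dataExceptGain (idx n)))
    (fun n => Downlink.measurable_serving (hbs n b S.buyer_mem) (hp n b S.buyer_mem_erase)
      (measurableSet_singleton n))
    (fun n => (measurable_pathLoss (hbs n b S.buyer_mem n) (hp n b S.buyer_mem_erase n)).prodMk
      (measurable_interferenceFrom S.seller_mem S.buyer_mem S.buyer_ne (hbs n) (hp n) (hgain n)))
    (fun ω => rfl) hg

end IsRegular

end ServingGain

end Downlink

/-! ### The total received power -/

namespace Downlink

variable {O Ω : Type*} [DecidableEq O]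

/-- Power received at the origin from the `n`-th base station of operator `k`, be it the seller or
a buyer. -/
def rxPower (D : Downlink O Ω) (k : O) (n : ℕ) (ω : Ω) : ℝ≥0∞ :=
  ENNReal.ofReal (D.txPower k n ω * D.gain k n ω * ‖D.bs k n ω‖ ^ (-D.α))

/-- Power received at the origin from all base stations: signal plus interference. -/
def totalPower (D : Downlink O Ω) (ω : Ω) : ℝ≥0∞ := ∑ k : D.group, ∑' n, D.rxPower k n ω

/-- Exponent `Λ` in `E[exp (-κ T); Z > t] = exp (-Λ)`, where `T` is the total received power and `Z`
the path loss variable of the serving base station of `b`. -/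
def laplaceExponent (D : Downlink O Ω) (b : O) (M κ t : ℝ) : ℝ :=
  ∑ k : D.group, D.intensity k * (Real.pi * D.txMoment M k
    * lossIntegral (D.α / 2) κ (if (k : O) = b then t else 0))

lemma bsCost_mark (D : Downlink O Ω) {κ : ℝ} (hκ : 0 ≤ κ) (t : ℝ) (k : O) (n : ℕ) (ω : Ω) :
    bsCost D.α κ t (D.bs k n ω, D.mark k n ω)
      = (if ‖D.bs k n ω‖ ^ 2 / D.txPower k n ω ^ (2 / D.α) ≤ t then ∞ else 0)
        + ENNReal.ofReal κ * D.rxPower k n ω := by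
  rw [bsCost, rxPower, ← ENNReal.ofReal_mul hκ]
  rfl

lemma pathLoss_pos {O Ω : Type*} {D : Downlink O Ω} {k : O} {n : ℕ} {ω : Ω}
    (hp : 0 < D.power k n ω) (hx : D.bs k n ω ≠ 0) : 0 < D.pathLoss k n ω := by
  unfold pathLoss
  positivity

lemma meanReceived_eq {O Ω : Type*} {D : Downlink O Ω} {k : O} {n : ℕ} {ω : Ω} (hα : D.α ≠ 0)
    (hp : 0 < D.power k n ω) : D.meanReceived k n ω = D.pathLoss k n ω ^ (-(D.α / 2)) := by
  rw [pathLoss, Real.rpow_neg (by positivity), sq_div_rpow_rpow hα (norm_nonneg _) hp.le, inv_div,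
    meanReceived, Real.rpow_neg (norm_nonneg _), div_eq_mul_inv]

namespace IsRegular

variable [MeasurableSpace Ω] {D : Downlink O Ω} {b : O} {P : Measure Ω} {powerLaw : Measure ℝ}
  {M : ℝ}

lemma α_pos (S : D.IsRegular b powerLaw M P) : 0 < D.α := two_pos.trans S.two_lt

lemma txPower_buyer (S : D.IsRegular b powerLaw M P) (n : ℕ) (ω : Ω) :
    D.txPower b n ω = D.power b n ω := if_neg S.buyer_ne

lemma ae_txLaw_pos (S : D.IsRegular b powerLaw M P) (k : O) :
    ∀ᵐ p ∂(D.txLaw powerLaw k), 0 < p := by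
  unfold txLaw
  split_ifs
  · rw [ae_dirac_iff measurableSet_Ioi]
    exact S.sellerPower_pos
  · exact S.ae_pos

lemma lintegral_txLaw_rpow (S : D.IsRegular b powerLaw M P) (k : O) :
    ∫⁻ p, ENNReal.ofReal (p ^ (2 / D.α)) ∂(D.txLaw powerLaw k)
      = ENNReal.ofReal (D.txMoment M k) := by
  unfold txLaw txMoment
  split_ifs
  · rw [lintegral_dirac' _ (by fun_prop)]
  · rw [S.moment_eq, ofReal_integral_eq_lintegral_ofReal S.integrable]
    filter_upwards [S.ae_pos] with p hp using Real.rpow_nonneg hp.le _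

lemma totalPower_eq (S : D.IsRegular b powerLaw M P) (ω : Ω) :
    D.totalPower ω = D.received b (D.serving b ω) ω + D.interference b ω := by
  have hrx : ∀ k, k ≠ D.seller → ∀ n, D.rxPower k n ω = D.received k n ω := fun k hk n => by
    rw [rxPower, received, txPower, if_neg hk]
  have hsub : ({D.seller, b} : Finset O) ⊆ D.group :=
    Finset.insert_subset S.seller_mem (Finset.singleton_subset_iff.2 S.buyer_mem)
  have hothers : ∑ k ∈ D.group \ {D.seller, b}, ∑' n, D.rxPower k n ω
      = ∑ k ∈ D.group \ {D.seller, b}, ∑' n, D.received k n ω := by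
    refine Finset.sum_congr rfl fun k hk => tsum_congr fun n => hrx k ?_ n
    simp only [Finset.mem_sdiff, Finset.mem_insert, not_or] at hk
    exact hk.2.1
  have hbuyer : ∑' n, D.rxPower b n ω = D.received b (D.serving b ω) ω
      + ∑' n, if n = D.serving b ω then 0 else D.received b n ω := by
    simp_rw [hrx b S.buyer_ne]
    convert ENNReal.tsum_eq_add_tsum_ite (f := fun n => D.received b n ω) (D.serving b ω)
  have hsell : ∑' n, D.rxPower D.seller n ω = ∑' n, ENNReal.ofReal
      (D.sellerPower * D.gain D.seller n ω * ‖D.bs D.seller n ω‖ ^ (-D.α)) := by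
    simp only [rxPower, txPower, if_true]
  rw [totalPower, Finset.sum_coe_sort D.group (fun k => ∑' n, D.rxPower k n ω),
    ← Finset.sum_sdiff hsub, hothers, Finset.sum_pair S.buyer_ne.symm, hbuyer, hsell, interference]
  ring

variable [IsProbabilityMeasure P]

lemma isProbabilityMeasure_powerLaw (S : D.IsRegular b powerLaw M P) :
    IsProbabilityMeasure powerLaw := by
  rw [← (S.model.power_law b S.buyer_mem_erase 0).map_eq]
  exact Measure.isProbabilityMeasure_map (S.measurable_power 0).aemeasurable

lemma isProbabilityMeasure_txLaw (S : D.IsRegular b powerLaw M P) (k : O) :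
    IsProbabilityMeasure (D.txLaw powerLaw k) := by
  have := S.isProbabilityMeasure_powerLaw
  unfold txLaw
  split_ifs <;> infer_instance

lemma moment_pos (S : D.IsRegular b powerLaw M P) : 0 < M := by
  have := S.isProbabilityMeasure_powerLaw
  have hpos : ∀ᵐ p ∂powerLaw, 0 < p ^ (2 / D.α) := by
    filter_upwards [S.ae_pos] with p hp using Real.rpow_pos_of_pos hp _
  have hnonneg : 0 ≤ᵐ[powerLaw] fun p => p ^ (2 / D.α) := hpos.mono fun p hp => hp.le
  rw [S.moment_eq]
  refine (integral_nonneg_of_ae hnonneg).lt_of_ne' fun hzero => ?_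
  obtain ⟨p, hp₀, hp⟩ :=
    (((integral_eq_zero_iff_of_nonneg_ae hnonneg S.integrable).1 hzero).and hpos).exists
  exact hp.ne' hp₀

lemma txMoment_nonneg (S : D.IsRegular b powerLaw M P) (k : O) : 0 ≤ D.txMoment M k := by
  unfold txMoment
  split_ifs
  · exact Real.rpow_nonneg S.sellerPower_pos.le _
  · exact S.moment_pos.le

lemma lintegral_bsCost_txLaw (S : D.IsRegular b powerLaw M P) (k : O) {κ t : ℝ} (hκ : 0 ≤ κ)
    (ht : 0 ≤ t) :
    ∫⁻ x, ∫⁻ e, 1 - expNeg (bsCost D.α κ t (x, e)) ∂((expMeasure 1).prod (D.txLaw powerLaw k))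
      = ENNReal.ofReal (Real.pi * D.txMoment M k * lossIntegral (D.α / 2) κ t) := by
  have := S.isProbabilityMeasure_txLaw k
  exact lintegral_bsCost S.two_lt hκ ht (S.ae_txLaw_pos k) (S.lintegral_txLaw_rpow k)

lemma ae_tsum_ne_top_of_le_bsCost (S : D.IsRegular b powerLaw M P) (k : D.group)
    {f : Plane × (ℝ × ℝ) → ℝ≥0∞} (hf : Measurable f) (hfin : ∀ q, f q ≠ ∞) {κ t : ℝ} (hκ : 0 ≤ κ)
    (ht : 0 ≤ t) (hle : ∀ q, f q ≤ bsCost D.α κ t q) :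
    ∀ᵐ ω ∂P, ∑' n, f (D.bs k n ω, D.mark k n ω) ≠ ∞ := by
  refine S.model.isMarkedPoisson.ae_tsum_ne_top k hf hfin (ne_top_of_le_ne_top ?_
    (lintegral_mono fun x => lintegral_mono fun e =>
      tsub_le_tsub_left (antitone_expNeg (hle (x, e))) 1))
  rw [S.lintegral_bsCost_txLaw k hκ ht]
  exact ENNReal.ofReal_ne_top

lemma ae_txPower_pos (S : D.IsRegular b powerLaw M P) :
    ∀ᵐ ω ∂P, ∀ (k : D.group) (n : ℕ), 0 < D.txPower k n ω := by
  refine ae_all_iff.2 fun k => ae_all_iff.2 fun n => ?_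
  refine ae_of_ae_map (S.model.measurable_txPower k.2 n).aemeasurable (p := fun p => 0 < p) ?_
  rw [S.model.map_txPower k.2]
  exact S.ae_txLaw_pos k

lemma ae_power_pos (S : D.IsRegular b powerLaw M P) : ∀ᵐ ω ∂P, ∀ n, 0 < D.power b n ω := by
  filter_upwards [S.ae_txPower_pos] with ω hω n
  exact (hω ⟨b, S.buyer_mem⟩ n).trans_eq (S.txPower_buyer n ω)

lemma ae_bs_ne_zero (S : D.IsRegular b powerLaw M P) :
    ∀ᵐ ω ∂P, ∀ (k : D.group) (n : ℕ), D.bs k n ω ≠ 0 :=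
  ae_all_iff.2 fun k => (S.model.bs_poisson k k.2).ae_ne 0

lemma ae_totalPower_ne_top (S : D.IsRegular b powerLaw M P) : ∀ᵐ ω ∂P, D.totalPower ω ≠ ∞ := by
  have hrx : ∀ k : D.group, ∀ᵐ ω ∂P, ∑' n, D.rxPower k n ω ≠ ∞ := fun k => by
    refine S.ae_tsum_ne_top_of_le_bsCost k
      (f := fun q => ENNReal.ofReal (q.2.2 * q.2.1 * ‖q.1‖ ^ (-D.α))) (by fun_prop)
      (fun q => ENNReal.ofReal_ne_top) zero_le_one le_rfl fun q => ?_
    rw [bsCost, one_mul]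
    exact le_add_self
  filter_upwards [ae_all_iff.2 hrx] with ω hω
  exact ENNReal.sum_ne_top.2 fun k _ => hω k

lemma ae_interference_ne_top (S : D.IsRegular b powerLaw M P) :
    ∀ᵐ ω ∂P, D.interference b ω ≠ ∞ := by
  filter_upwards [S.ae_totalPower_ne_top] with ω hω
  rw [S.totalPower_eq] at hω
  exact (ENNReal.add_ne_top.1 hω).2

lemma ae_finite_pathLoss_le (S : D.IsRegular b powerLaw M P) :
    ∀ᵐ ω ∂P, ∀ t : ℕ, {n | D.pathLoss b n ω ≤ t}.Finite := by
  refine ae_all_iff.2 fun t => ?_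
  have hnear : MeasurableSet {q : Plane × (ℝ × ℝ) | ‖q.1‖ ^ 2 / q.2.2 ^ (2 / D.α) ≤ t} :=
    measurableSet_le (by fun_prop) measurable_const
  have hsum := S.ae_tsum_ne_top_of_le_bsCost ⟨b, S.buyer_mem⟩
    (f := fun q => if ‖q.1‖ ^ 2 / q.2.2 ^ (2 / D.α) ≤ t then 1 else 0)
    (Measurable.ite hnear measurable_const measurable_const) (fun q => by split_ifs <;> simp)
    le_rfl t.cast_nonneg fun q => by
      rw [bsCost]
      refine le_trans ?_ le_self_add
      split_ifs <;> simp
  filter_upwards [hsum] with ω hω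
  refine (ENNReal.finite_const_le_of_tsum_ne_top hω one_ne_zero).subset fun n hn => ?_
  simp only [mem_ofPred_eq, mark, S.txPower_buyer, pathLoss] at hn ⊢
  rw [if_pos hn]

lemma ae_servingZ_le (S : D.IsRegular b powerLaw M P) :
    ∀ᵐ ω ∂P, ∀ n, D.servingZ b ω ≤ D.pathLoss b n ω := by
  filter_upwards [S.ae_power_pos, S.ae_bs_ne_zero, S.ae_finite_pathLoss_le] with ω hp hx hfin n
  have hpos : ∀ n, 0 < D.pathLoss b n ω := fun n => pathLoss_pos (hp n) (hx ⟨b, S.buyer_mem⟩ n)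
  have hiff : ∀ m n, D.meanReceived b m ω ≤ D.meanReceived b n ω
      ↔ D.pathLoss b n ω ≤ D.pathLoss b m ω := fun m n => by
    rw [meanReceived_eq S.α_pos.ne' (hp m), meanReceived_eq S.α_pos.ne' (hp n),
      Real.rpow_le_rpow_iff_of_neg (hpos m) (hpos n) (by linarith [S.α_pos])]
  have hmax : {n | ∀ m, D.meanReceived b m ω ≤ D.meanReceived b n ω}.Nonempty := by
    obtain ⟨t, ht⟩ := exists_nat_ge (D.pathLoss b 0 ω)
    obtain ⟨n, hn, hmin⟩ := exists_min_image _ (fun n => D.pathLoss b n ω) (hfin t) ⟨0, ht⟩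
    refine ⟨n, fun m => (hiff m n).2 ?_⟩
    rcases le_or_gt (D.pathLoss b m ω) t with hm | hm
    · exact hmin m hm
    · exact le_trans hn hm.le
  exact (hiff n _).1 (Nat.sInf_mem hmax n)

lemma ae_servingZ_pos (S : D.IsRegular b powerLaw M P) : ∀ᵐ ω ∂P, 0 < D.servingZ b ω := by
  filter_upwards [S.ae_power_pos, S.ae_bs_ne_zero] with ω hp hx
  exact pathLoss_pos (hp _) (hx ⟨b, S.buyer_mem⟩ _)

lemma ae_received_serving (S : D.IsRegular b powerLaw M P) :
    ∀ᵐ ω ∂P, D.received b (D.serving b ω) ω = ENNReal.ofReal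
      (D.servingZ b ω ^ (-(D.α / 2)) * D.gain b (D.serving b ω) ω) := by
  filter_upwards [S.ae_power_pos] with ω hp
  have hmean : D.meanReceived b (D.serving b ω) ω = D.servingZ b ω ^ (-(D.α / 2)) :=
    meanReceived_eq S.α_pos.ne' (hp _)
  rw [← hmean, received, meanReceived, mul_right_comm]

lemma ae_expNeg_sum_bsCost (S : D.IsRegular b powerLaw M P) {κ : ℝ} (hκ : 0 ≤ κ) (t : ℝ) :
    ∀ᵐ ω ∂P, expNeg (∑ k : D.group, ∑' n,
        bsCost D.α κ (if (k : O) = b then t else 0) (D.bs k n ω, D.mark k n ω))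
      = {ω | t < D.servingZ b ω}.indicator
        (fun ω => expNeg (ENNReal.ofReal κ * D.totalPower ω)) ω := by
  filter_upwards [S.ae_servingZ_le, S.ae_txPower_pos, S.ae_bs_ne_zero] with ω hle hp hx
  simp_rw [D.bsCost_mark hκ]
  by_cases hZ : t < D.servingZ b ω
  · have hfar : ∀ (k : D.group) (n : ℕ), ¬‖D.bs k n ω‖ ^ 2 / D.txPower k n ω ^ (2 / D.α)
        ≤ if (k : O) = b then t else 0 := fun k n => by
      split_ifs with hk
      · rw [hk, S.txPower_buyer]
        exact (hZ.trans_le (hle n)).not_ge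
      · have := hp k n
        have := hx k n
        exact not_le.2 (by positivity)
    rw [indicator_of_mem (by exact hZ), totalPower, Finset.mul_sum]
    simp_rw [if_neg (hfar _ _), zero_add, ENNReal.tsum_mul_left]
  · rw [indicator_of_notMem (by exact hZ), expNeg_eq_zero_iff]
    refine ENNReal.sum_eq_top.2 ⟨⟨b, S.buyer_mem⟩, Finset.mem_univ _,
      ENNReal.tsum_eq_top_of_eq_top ⟨D.serving b ω, ?_⟩⟩
    have hnear : ‖D.bs b (D.serving b ω) ω‖ ^ 2 / D.power b (D.serving b ω) ω ^ (2 / D.α) ≤ t :=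
      not_lt.1 hZ
    rw [if_pos rfl, S.txPower_buyer, if_pos hnear, top_add]

lemma lintegral_totalPower (S : D.IsRegular b powerLaw M P) {κ t : ℝ} (hκ : 0 ≤ κ) (ht : 0 ≤ t) :
    ∫⁻ ω, {ω | t < D.servingZ b ω}.indicator
        (fun ω => expNeg (ENNReal.ofReal κ * D.totalPower ω)) ω ∂P
      = ENNReal.ofReal (Real.exp (-D.laplaceExponent b M κ t)) := by
  have ht' : ∀ k : O, 0 ≤ if k = b then t else 0 := fun k => by split_ifs <;> simp [ht]
  have hnonneg : ∀ k : D.group, 0 ≤ (D.intensity k : ℝ) * (Real.pi * D.txMoment M k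
      * lossIntegral (D.α / 2) κ (if (k : O) = b then t else 0)) := fun k =>
    mul_nonneg (NNReal.coe_nonneg _) (mul_nonneg (mul_nonneg Real.pi_nonneg (S.txMoment_nonneg k))
      ((ht' k).trans (le_lossIntegral _ _ hκ)))
  rw [← lintegral_congr_ae (S.ae_expNeg_sum_bsCost hκ t),
    S.model.isMarkedPoisson.laplace fun k => measurable_bsCost _ _ _]
  simp_rw [S.lintegral_bsCost_txLaw _ hκ (ht' _), ← ENNReal.ofReal_coe_nnreal,
    ← ENNReal.ofReal_mul (NNReal.coe_nonneg _)]
  rw [← ENNReal.ofReal_sum_of_nonneg fun k _ => hnonneg k,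
    expNeg_ofReal (Finset.sum_nonneg fun k _ => hnonneg k), laplaceExponent]

end IsRegular

end Downlink

/-! ### The Laplace exponent -/

namespace Downlink

variable {O Ω : Type*} [DecidableEq O]

/-- The part of the Laplace exponent due to the operators other than `b`. -/
def crossExponent (D : Downlink O Ω) (b : O) (M κ : ℝ) : ℝ :=
  ∑ k ∈ D.group.erase b, D.intensity k * (Real.pi * D.txMoment M k * lossIntegral (D.α / 2) κ 0)

/-- Density in `u` of the measure `E[exp (-κ I); Z ∈ du]`, where `I` is the interference and `Z` the
path loss variable of the serving base station of `b`. -/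
def servingDensity (D : Downlink O Ω) (b : O) (M κ u : ℝ) : ℝ :=
  Real.pi * D.intensity b * M * Real.exp (-D.laplaceExponent b M κ u)

@[fun_prop]
lemma measurable_servingDensity (D : Downlink O Ω) (b : O) (M κ : ℝ) :
    Measurable (D.servingDensity b M κ) := by
  have : ∀ k : D.group,
      Measurable fun u => lossIntegral (D.α / 2) κ (if (k : O) = b then u else 0) := fun k =>
    (measurable_lossIntegral (D.α / 2)).comp (f := fun u => (κ, if (k : O) = b then u else 0))
      (measurable_const.prodMk (by split_ifs <;> fun_prop))
  unfold servingDensity laplaceExponent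
  fun_prop

namespace IsRegular

variable [MeasurableSpace Ω] {D : Downlink O Ω} {b : O} {P : Measure Ω} {powerLaw : Measure ℝ}
  {M : ℝ}

lemma one_lt_half (S : D.IsRegular b powerLaw M P) : 1 < D.α / 2 := by linarith [S.two_lt]

lemma laplaceExponent_eq (S : D.IsRegular b powerLaw M P) (κ t : ℝ) :
    D.laplaceExponent b M κ t
      = Real.pi * D.intensity b * M * lossIntegral (D.α / 2) κ t + D.crossExponent b M κ := by
  rw [laplaceExponent, Finset.sum_coe_sort D.group (fun k => (D.intensity k : ℝ) *
    (Real.pi * D.txMoment M k * lossIntegral (D.α / 2) κ (if k = b then t else 0))),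
    ← Finset.add_sum_erase _ _ S.buyer_mem, crossExponent, if_pos rfl, txMoment,
    if_neg S.buyer_ne]
  congr 1
  · ring
  · exact Finset.sum_congr rfl fun k hk => by rw [if_neg (Finset.ne_of_mem_erase hk)]

lemma hasDerivAt_laplaceExponent (S : D.IsRegular b powerLaw M P) {κ : ℝ} (hκ : 0 ≤ κ) (t : ℝ) :
    HasDerivAt (D.laplaceExponent b M κ)
      (Real.pi * D.intensity b * M * (1 - fadingLoss (D.α / 2) κ t)) t := by
  rw [funext (S.laplaceExponent_eq κ)]
  exact ((hasDerivAt_lossIntegral S.one_lt_half hκ t).const_mul _).add_const _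

lemma continuous_laplaceExponent_left (S : D.IsRegular b powerLaw M P) {t : ℝ} (ht : 0 ≤ t) :
    Continuous fun κ : ℝ≥0 => D.laplaceExponent b M κ t :=
  continuous_finsetSum _ fun k _ => ((continuous_lossIntegral_left S.one_lt_half
    (by split_ifs <;> simp [ht])).const_mul _).const_mul _

lemma crossExponent_eq (S : D.IsRegular b powerLaw M P) {κ : ℝ} (hκ : 0 < κ) :
    D.crossExponent b M κ
      = Real.pi * D.intensity D.seller * D.sellerPower ^ (2 / D.α) * κ ^ (2 / D.α) * rhoInf D.α
        + Real.pi * (∑ k ∈ D.group \ {D.seller, b}, (D.intensity k : ℝ)) * M * κ ^ (2 / D.α)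
          * rhoInf D.α := by
  have hmem : D.seller ∈ D.group.erase b := Finset.mem_erase.2 ⟨S.buyer_ne.symm, S.seller_mem⟩
  have hset : (D.group.erase b).erase D.seller = D.group \ {D.seller, b} := by
    ext k
    simp only [Finset.mem_erase, Finset.mem_sdiff, Finset.mem_insert, Finset.mem_singleton]
    tauto
  have hothers : ∀ k ∈ D.group \ {D.seller, b}, D.txMoment M k = M := fun k hk => by
    simp only [Finset.mem_sdiff, Finset.mem_insert, not_or] at hk
    exact if_neg hk.2.1
  rw [crossExponent, lossIntegral_zero_right S.α_pos hκ, ← Finset.add_sum_erase _ _ hmem, hset,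
    Finset.sum_congr rfl fun k hk => by rw [hothers k hk], ← Finset.sum_mul, txMoment, if_pos rfl]
  ring

lemma exp_neg_laplaceExponent (S : D.IsRegular b powerLaw M P) {β u : ℝ} (hβ : 0 < β)
    (hu : 0 < u) :
    Real.exp (-D.laplaceExponent b M (β * u ^ (D.α / 2)) u)
      = Real.exp (-(Real.pi * D.intensity b * M * u))
        * laplaceFormula D b β M (β * u ^ (D.α / 2)) := by
  rw [S.laplaceExponent_eq, S.crossExponent_eq (by positivity),
    lossIntegral_mul_rpow S.α_pos hβ hu, laplaceFormula, ← Real.exp_add, ← Real.exp_add,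
    ← Real.exp_add]
  congr 1
  ring

variable [IsProbabilityMeasure P]

lemma rate_pos (S : D.IsRegular b powerLaw M P) : 0 < Real.pi * D.intensity b * M :=
  mul_pos (mul_pos Real.pi_pos S.intensity_pos) S.moment_pos

lemma le_laplaceExponent (S : D.IsRegular b powerLaw M P) {κ : ℝ} (hκ : 0 ≤ κ) (t : ℝ) :
    Real.pi * D.intensity b * M * t ≤ D.laplaceExponent b M κ t := by
  have hcross : 0 ≤ D.crossExponent b M κ := Finset.sum_nonneg fun k _ =>
    mul_nonneg (NNReal.coe_nonneg _) (mul_nonneg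
      (mul_nonneg Real.pi_nonneg (S.txMoment_nonneg k)) (le_lossIntegral _ _ hκ))
  rw [S.laplaceExponent_eq]
  exact le_add_of_le_of_nonneg
    (mul_le_mul_of_nonneg_left (le_lossIntegral _ _ hκ) S.rate_pos.le) hcross

lemma tendsto_laplaceExponent_atTop (S : D.IsRegular b powerLaw M P) {κ : ℝ} (hκ : 0 ≤ κ) :
    Filter.Tendsto (D.laplaceExponent b M κ) Filter.atTop Filter.atTop :=
  Filter.tendsto_atTop_mono (S.le_laplaceExponent hκ)
    (Filter.tendsto_id.const_mul_atTop S.rate_pos)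

/-! ### Joint law of the serving base station and the interference -/

lemma lintegral_expNeg_totalPower (S : D.IsRegular b powerLaw M P) {κ : ℝ} (hκ : 0 ≤ κ)
    {φ : ℝ → ℝ≥0∞} (hφ : Measurable φ) :
    ∫⁻ ω, φ (D.servingZ b ω) * expNeg (ENNReal.ofReal κ * D.totalPower ω) ∂P
      = ∫⁻ ω, φ (D.servingZ b ω) * (ENNReal.ofReal (1 - fadingLoss (D.α / 2) κ (D.servingZ b ω))
          * expNeg (ENNReal.ofReal κ * D.interference b ω)) ∂P := by
  calc ∫⁻ ω, φ (D.servingZ b ω) * expNeg (ENNReal.ofReal κ * D.totalPower ω) ∂P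
      = ∫⁻ ω, φ (D.servingZ b ω) * (expNeg (ENNReal.ofReal
          (κ * D.servingZ b ω ^ (-(D.α / 2)) * D.gain b (D.serving b ω) ω))
            * expNeg (ENNReal.ofReal κ * D.interference b ω)) ∂P := by
        refine lintegral_congr_ae ?_
        filter_upwards [S.ae_received_serving] with ω hω
        rw [S.totalPower_eq, hω, mul_add, expNeg_add, ← ENNReal.ofReal_mul hκ, mul_assoc κ]
    _ = ∫⁻ ω, ∫⁻ h, φ (D.servingZ b ω) * (expNeg (ENNReal.ofReal
          (κ * D.servingZ b ω ^ (-(D.α / 2)) * h))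
            * expNeg (ENNReal.ofReal κ * D.interference b ω)) ∂(expMeasure 1) ∂P :=
        S.lintegral_serving_gain (g := fun q => φ q.2.1 * (expNeg (ENNReal.ofReal
          (κ * q.2.1 ^ (-(D.α / 2)) * q.1)) * expNeg (ENNReal.ofReal κ * q.2.2))) (by fun_prop)
    _ = _ := by
        refine lintegral_congr_ae ?_
        filter_upwards [S.ae_servingZ_pos] with ω hZ
        rw [lintegral_const_mul _ (by fun_prop), lintegral_mul_const _ (by fun_prop),
          lintegral_expNeg_gain _ hκ hZ]

lemma map_servingZ_withDensity_fadingLoss_Ioi (S : D.IsRegular b powerLaw M P) {κ t : ℝ}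
    (hκ : 0 ≤ κ) (ht : 0 ≤ t) :
    (P.withDensity fun ω => ENNReal.ofReal (1 - fadingLoss (D.α / 2) κ (D.servingZ b ω))
        * expNeg (ENNReal.ofReal κ * D.interference b ω)).map (D.servingZ b) (Ioi t)
      = ENNReal.ofReal (Real.exp (-D.laplaceExponent b M κ t)) := by
  have hZ := S.measurable_servingZ
  have hφ : Measurable ((Ioi t).indicator (1 : ℝ → ℝ≥0∞)) := by measurability
  have hind : ∀ (f : Ω → ℝ≥0∞) ω, (Ioi t).indicator 1 (D.servingZ b ω) * f ω
      = (D.servingZ b ⁻¹' Ioi t).indicator f ω := fun f ω => by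
    by_cases h : D.servingZ b ω ∈ Ioi t <;> simp [indicator, h]
  rw [Measure.map_apply hZ measurableSet_Ioi, withDensity_apply _ (hZ measurableSet_Ioi),
    ← lintegral_indicator (hZ measurableSet_Ioi), ← S.lintegral_totalPower hκ ht]
  simp_rw [← hind]
  rw [← S.lintegral_expNeg_totalPower hκ hφ]
  exact lintegral_congr fun ω =>
    hind (fun ω => expNeg (ENNReal.ofReal κ * D.totalPower ω)) ω

lemma withDensity_servingDensity_Ioi (S : D.IsRegular b powerLaw M P) {κ t : ℝ} (hκ : 0 ≤ κ)
    (ht : 0 ≤ t) :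
    ((volume.restrict (Ioi 0)).withDensity fun u =>
        ENNReal.ofReal (1 - fadingLoss (D.α / 2) κ u)
          * ENNReal.ofReal (D.servingDensity b M κ u)) (Ioi t)
      = ENNReal.ofReal (Real.exp (-D.laplaceExponent b M κ t)) := by
  have hloss : ∀ u, 0 ≤ 1 - fadingLoss (D.α / 2) κ u := fun u =>
    sub_nonneg.2 (fadingLoss_le_one _ u hκ)
  rw [withDensity_apply _ measurableSet_Ioi, Measure.restrict_restrict measurableSet_Ioi,
    Ioi_inter_Ioi, max_eq_left ht, ← lintegral_Ioi_deriv_mul_exp_neg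
      (fun u _ => S.hasDerivAt_laplaceExponent hκ u)
      (fun u _ => mul_nonneg S.rate_pos.le (hloss u)) (S.tendsto_laplaceExponent_atTop hκ)]
  refine lintegral_congr fun u => ?_
  rw [← ENNReal.ofReal_mul (hloss u), servingDensity]
  congr 1
  ring

lemma map_servingZ_withDensity_fadingLoss (S : D.IsRegular b powerLaw M P) {κ : ℝ} (hκ : 0 ≤ κ) :
    (P.withDensity fun ω => ENNReal.ofReal (1 - fadingLoss (D.α / 2) κ (D.servingZ b ω))
        * expNeg (ENNReal.ofReal κ * D.interference b ω)).map (D.servingZ b)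
      = (volume.restrict (Ioi 0)).withDensity fun u =>
        ENNReal.ofReal (1 - fadingLoss (D.α / 2) κ u)
          * ENNReal.ofReal (D.servingDensity b M κ u) := by
  have hle : ∀ ω, ENNReal.ofReal (1 - fadingLoss (D.α / 2) κ (D.servingZ b ω))
      * expNeg (ENNReal.ofReal κ * D.interference b ω) ≤ 1 := fun ω =>
    mul_le_one' (ENNReal.ofReal_le_one.2 (sub_le_self _ (fadingLoss_nonneg _ _ hκ)))
      (expNeg_le_one _)
  have : IsFiniteMeasure (P.withDensity fun ω => ENNReal.ofReal
      (1 - fadingLoss (D.α / 2) κ (D.servingZ b ω))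
        * expNeg (ENNReal.ofReal κ * D.interference b ω)) :=
    isFiniteMeasure_withDensity (ne_top_of_le_ne_top (by simp) (lintegral_mono hle))
  refine ext_of_Ioi_of_Iic_eq_zero (a := 0) ?_ ?_ fun t ht => ?_
  · rw [Measure.map_apply S.measurable_servingZ measurableSet_Iic]
    refine withDensity_absolutelyContinuous _ _ (measure_mono_null (fun ω hω => ?_)
      (ae_iff.1 S.ae_servingZ_pos))
    exact not_lt.2 hω
  · refine withDensity_absolutelyContinuous _ _ ?_
    rw [Measure.restrict_apply measurableSet_Iic, Iic_inter_Ioi, Ioc_self, measure_empty]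
  · rw [S.map_servingZ_withDensity_fadingLoss_Ioi hκ ht, S.withDensity_servingDensity_Ioi hκ ht]

lemma map_servingZ_withDensity_const (S : D.IsRegular b powerLaw M P) {κ : ℝ} (hκ : 0 ≤ κ) :
    (P.withDensity fun ω => expNeg (ENNReal.ofReal κ * D.interference b ω)).map (D.servingZ b)
      = (volume.restrict (Ioi 0)).withDensity fun u =>
        ENNReal.ofReal (D.servingDensity b M κ u) := by
  have hZ := S.measurable_servingZ
  have hI := S.measurable_interference
  have : Measurable fun u => fadingLoss (D.α / 2) κ u :=
    (measurable_fadingLoss _).comp (measurable_const.prodMk measurable_id)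
  have hw : Measurable fun u => ENNReal.ofReal (1 - fadingLoss (D.α / 2) κ u) := by fun_prop
  have hw₀ : ∀ u, 0 < u → ENNReal.ofReal (1 - fadingLoss (D.α / 2) κ u) ≠ 0 := fun u hu =>
    (ENNReal.ofReal_pos.2 (sub_pos.2 (fadingLoss_lt_one _ hκ hu))).ne'
  refine withDensity_right_cancel hw ?_ ?_ (fun u => ENNReal.ofReal_ne_top) ?_
  · have hpos : ∀ᵐ u ∂(P.map (D.servingZ b)), 0 < u :=
      (ae_map_iff hZ.aemeasurable measurableSet_Ioi).2 S.ae_servingZ_pos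
    have hac := (withDensity_absolutelyContinuous P
      fun ω => expNeg (ENNReal.ofReal κ * D.interference b ω)).map hZ
    filter_upwards [hac.ae_le hpos] with u hu using hw₀ u hu
  · refine (withDensity_absolutelyContinuous _ _).ae_le ?_
    filter_upwards [ae_restrict_mem measurableSet_Ioi] with u hu using hw₀ u hu
  · rw [← map_withDensity_mul_comp hZ hw (by fun_prop), S.map_servingZ_withDensity_fadingLoss hκ,
      ← withDensity_mul _ (by fun_prop) hw]
    simp only [Pi.mul_def, mul_comm]

end IsRegular

end Downlink

namespace Downlink

variable {O Ω : Type*} [DecidableEq O]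

lemma laplaceFormula_nonneg (D : Downlink O Ω) (b : O) (β M κ : ℝ) :
    0 ≤ laplaceFormula D b β M κ := by
  unfold laplaceFormula
  positivity

@[fun_prop]
lemma measurable_laplaceFormula (D : Downlink O Ω) (b : O) (β M : ℝ) :
    Measurable (laplaceFormula D b β M) := by
  unfold laplaceFormula
  fun_prop

lemma measurable_coverageIntegrand (D : Downlink O Ω) (b : O) (β M : ℝ) :
    Measurable (coverageIntegrand D b β M) := by
  unfold coverageIntegrand
  fun_prop

namespace IsRegular

variable [MeasurableSpace Ω] {D : Downlink O Ω} {b : O} {P : Measure Ω} [IsProbabilityMeasure P]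
  {powerLaw : Measure ℝ} {M : ℝ}

lemma servingDensity_le (S : D.IsRegular b powerLaw M P) {κ : ℝ} (hκ : 0 ≤ κ) (u : ℝ) :
    D.servingDensity b M κ u ≤ Real.pi * D.intensity b * M
      * Real.exp (-(Real.pi * D.intensity b * M) * u) := by
  rw [neg_mul]
  exact mul_le_mul_of_nonneg_left (Real.exp_le_exp.2 (neg_le_neg (S.le_laplaceExponent hκ u)))
    S.rate_pos.le

lemma lintegral_exp_neg_rate_ne_top (S : D.IsRegular b powerLaw M P) :
    ∫⁻ u in Ioi 0, ENNReal.ofReal (Real.pi * D.intensity b * M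
      * Real.exp (-(Real.pi * D.intensity b * M) * u)) ≠ ∞ :=
  ((integrableOn_exp_mul_Ioi (neg_lt_zero.2 S.rate_pos) 0).const_mul
    (Real.pi * D.intensity b * M)).lintegral_lt_top.ne

lemma map_servingZ_withDensity (S : D.IsRegular b powerLaw M P) {κ : ℝ → ℝ≥0}
    (hκ : Measurable κ) :
    (P.withDensity fun ω => expNeg (ENNReal.ofReal (κ (D.servingZ b ω)) * D.interference b ω)).map
        (D.servingZ b)
      = (volume.restrict (Ioi 0)).withDensity fun u =>
        ENNReal.ofReal (D.servingDensity b M (κ u) u) := by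
  have hI := S.measurable_interference
  refine map_withDensity_of_forall_const S.measurable_servingZ (C := ℝ≥0)
    (F := fun c ω => expNeg (ENNReal.ofReal c * D.interference b ω))
    (G := fun c u => ENNReal.ofReal (D.servingDensity b M c u)) (fun c => by fun_prop)
    (fun c => by fun_prop) ?_ ?_ (fun c ω => expNeg_le_one _)
    (.of_forall fun u c => ENNReal.ofReal_le_ofReal (S.servingDensity_le c.2 u))
    S.lintegral_exp_neg_rate_ne_top (fun c => S.map_servingZ_withDensity_const c.2)
    hκ.stronglyMeasurable
  · filter_upwards [S.ae_interference_ne_top] with ω hω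
    exact continuous_expNeg.comp ((ENNReal.continuous_mul_const hω).comp
      (ENNReal.continuous_ofReal.comp NNReal.continuous_coe))
  · filter_upwards [ae_restrict_mem measurableSet_Ioi] with u hu
    exact ENNReal.continuous_ofReal.comp (continuous_const.mul
      (Real.continuous_exp.comp (S.continuous_laplaceExponent_left (mem_Ioi.1 hu).le).neg))

lemma map_servingZ (S : D.IsRegular b powerLaw M P) :
    P.map (D.servingZ b) = (volume.restrict (Ioi 0)).withDensity fun u => ENNReal.ofReal
      (Real.pi * D.intensity b * M * Real.exp (-(Real.pi * D.intensity b * M * u))) := by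
  have hzero : ∀ u, D.laplaceExponent b M 0 u = Real.pi * D.intensity b * M * u := fun u => by
    simp [S.laplaceExponent_eq, crossExponent, lossIntegral_zero_left]
  simpa [servingDensity, hzero] using S.map_servingZ_withDensity_const le_rfl

lemma map_servingZ_withDensity_pathLoss (S : D.IsRegular b powerLaw M P) {β : ℝ} (hβ : 0 < β) :
    (P.withDensity fun ω => expNeg
        (ENNReal.ofReal (β * D.servingZ b ω ^ (D.α / 2)) * D.interference b ω)).map (D.servingZ b)
      = (P.map (D.servingZ b)).withDensity fun z =>
        ENNReal.ofReal (laplaceFormula D b β M (β * z ^ (D.α / 2))) := by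
  have h := S.map_servingZ_withDensity (κ := fun z => (β * z ^ (D.α / 2)).toNNReal) (by fun_prop)
  have hcoe : ∀ x : ℝ, ENNReal.ofReal x.toNNReal = ENNReal.ofReal x := fun x =>
    ENNReal.ofReal_coe_nnreal
  simp only [hcoe] at h
  rw [h, S.map_servingZ, ← withDensity_mul _ (by fun_prop) (by fun_prop)]
  refine withDensity_congr_ae ?_
  filter_upwards [ae_restrict_mem measurableSet_Ioi] with u hu
  have hu₀ : 0 < u := hu
  rw [Pi.mul_apply, ← ENNReal.ofReal_mul (mul_nonneg S.rate_pos.le (Real.exp_nonneg _)),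
    Real.coe_toNNReal _ (by positivity), servingDensity, S.exp_neg_laplaceExponent hβ hu₀,
    ← mul_assoc]

/-! ### Conditional Laplace transform and coverage probability -/

lemma condExp_interference (S : D.IsRegular b powerLaw M P) {β : ℝ} (hβ : 0 < β) :
    P[fun ω => Real.exp (-(β * D.servingZ b ω ^ (D.α / 2) * (D.interference b ω).toReal)) |
        MeasurableSpace.comap (D.servingZ b) inferInstance]
      =ᵐ[P] (fun ω => laplaceFormula D b β M (β * D.servingZ b ω ^ (D.α / 2))) := by
  have hZ := S.measurable_servingZ
  have hI := S.measurable_interference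
  have hfint : Integrable (fun ω =>
      Real.exp (-(β * D.servingZ b ω ^ (D.α / 2) * (D.interference b ω).toReal))) P := by
    refine Integrable.of_bound (by fun_prop) 1 ?_
    filter_upwards [S.ae_servingZ_pos] with ω hω
    rw [Real.norm_of_nonneg (Real.exp_nonneg _), Real.exp_le_one_iff, neg_nonpos]
    positivity
  refine condExp_comap_of_map_withDensity hZ hfint (.of_forall fun ω => Real.exp_nonneg _)
    (g := fun z => laplaceFormula D b β M (β * z ^ (D.α / 2))) (by fun_prop)
    (fun z => laplaceFormula_nonneg _ _ _ _ _) ?_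
  rw [← S.map_servingZ_withDensity_pathLoss hβ]
  congr 1
  refine withDensity_congr_ae ?_
  filter_upwards [S.ae_servingZ_pos, S.ae_interference_ne_top] with ω hω hωI
  rw [expNeg_eq_ofReal (ENNReal.mul_ne_top ENNReal.ofReal_ne_top hωI), ENNReal.toReal_mul,
    ENNReal.toReal_ofReal (by positivity)]

lemma ae_lt_sinr_iff (S : D.IsRegular b powerLaw M P) {β : ℝ} (hβ : 0 < β) :
    ∀ᵐ ω ∂P, ENNReal.ofReal β < D.sinr b ω
      ↔ ENNReal.ofReal (β * D.servingZ b ω ^ (D.α / 2))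
          * (D.interference b ω + ENNReal.ofReal (D.σ ^ 2))
        < ENNReal.ofReal (D.gain b (D.serving b ω) ω) := by
  filter_upwards [S.ae_servingZ_pos, S.ae_interference_ne_top, S.ae_received_serving]
    with ω hω hωI hrec
  have hpw : 0 < D.servingZ b ω ^ (D.α / 2) := Real.rpow_pos_of_pos hω _
  have hdiv : D.received b (D.serving b ω) ω = ENNReal.ofReal (D.gain b (D.serving b ω) ω)
      / ENNReal.ofReal (D.servingZ b ω ^ (D.α / 2)) := by
    rw [hrec, ← ENNReal.ofReal_div_of_pos hpw, Real.rpow_neg hω.le, inv_mul_eq_div]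
  rw [sinr, ENNReal.lt_div_iff_mul_lt (Or.inr ENNReal.ofReal_ne_top)
    (Or.inl (ENNReal.add_ne_top.2 ⟨hωI, ENNReal.ofReal_ne_top⟩)), hdiv,
    ENNReal.lt_div_iff_mul_lt (Or.inl (by simpa using hpw)) (Or.inl ENNReal.ofReal_ne_top),
    ENNReal.ofReal_mul hβ.le, mul_right_comm]

lemma measure_lt_sinr_eq_lintegral_expNeg (S : D.IsRegular b powerLaw M P) {β : ℝ} (hβ : 0 < β) :
    P {ω | ENNReal.ofReal β < D.sinr b ω}
      = ∫⁻ ω, expNeg (ENNReal.ofReal (β * D.servingZ b ω ^ (D.α / 2))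
          * (D.interference b ω + ENNReal.ofReal (D.σ ^ 2))) ∂P := by
  set B : Set (ℝ × (ℝ × ℝ≥0∞)) := {q | ENNReal.ofReal (β * q.2.1 ^ (D.α / 2))
    * (q.2.2 + ENNReal.ofReal (D.σ ^ 2)) < ENNReal.ofReal q.1}
  have hB : MeasurableSet B := measurableSet_lt (by fun_prop) (by fun_prop)
  have hgain : Measurable fun ω => D.gain b (D.serving b ω) ω :=
    measurable_apply_of_countable S.measurable_serving
      fun n => S.model.gain_measurable b S.buyer_mem n
  have hmeas : Measurable fun ω =>
      (D.gain b (D.serving b ω) ω, (D.servingZ b ω, D.interference b ω)) :=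
    hgain.prodMk (S.measurable_servingZ.prodMk S.measurable_interference)
  calc P {ω | ENNReal.ofReal β < D.sinr b ω}
      = P ((fun ω => (D.gain b (D.serving b ω) ω, (D.servingZ b ω, D.interference b ω))) ⁻¹' B) :=
        measure_congr ((S.ae_lt_sinr_iff hβ).mono fun ω hω => propext hω)
    _ = ∫⁻ ω, B.indicator 1
          (D.gain b (D.serving b ω) ω, (D.servingZ b ω, D.interference b ω)) ∂P := by
        rw [← lintegral_indicator_one (hmeas hB)]
        rfl
    _ = ∫⁻ ω, ∫⁻ h, B.indicator 1 (h, (D.servingZ b ω, D.interference b ω)) ∂(expMeasure 1) ∂P :=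
        S.lintegral_serving_gain (measurable_one.indicator hB)
    _ = _ := by
        refine lintegral_congr fun ω => ?_
        rw [← expMeasure_lt_ofReal, ← lintegral_indicator_one
          (measurableSet_lt measurable_const (by fun_prop))]
        rfl

lemma coverageIntegrand_nonneg (S : D.IsRegular b powerLaw M P) (β z : ℝ) :
    0 ≤ coverageIntegrand D b β M z :=
  mul_nonneg (mul_nonneg (mul_nonneg S.rate_pos.le (Real.exp_nonneg _)) (Real.exp_nonneg _))
    (laplaceFormula_nonneg _ _ _ _ _)

lemma measure_lt_sinr (S : D.IsRegular b powerLaw M P) {β : ℝ} (hβ : 0 < β) :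
    P {ω | ENNReal.ofReal β < D.sinr b ω}
      = ∫⁻ z in Ioi 0, ENNReal.ofReal (coverageIntegrand D b β M z) := by
  have hZ := S.measurable_servingZ
  have hI := S.measurable_interference
  set noise : ℝ → ℝ≥0∞ :=
    fun z => expNeg (ENNReal.ofReal (β * z ^ (D.α / 2)) * ENNReal.ofReal (D.σ ^ 2)) with hnoise
  have hnm : Measurable noise := by fun_prop
  have hrate := S.rate_pos
  have hsplit : P {ω | ENNReal.ofReal β < D.sinr b ω}
      = ∫⁻ z, noise z ∂((P.withDensity fun ω => expNeg (ENNReal.ofReal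
          (β * D.servingZ b ω ^ (D.α / 2)) * D.interference b ω)).map (D.servingZ b)) := by
    rw [S.measure_lt_sinr_eq_lintegral_expNeg hβ, lintegral_map hnm hZ,
      lintegral_withDensity_eq_lintegral_mul _ (by fun_prop)
        (show Measurable fun ω => noise (D.servingZ b ω) from hnm.comp hZ)]
    simp only [mul_add, expNeg_add, Pi.mul_apply, hnoise]
  rw [hsplit, S.map_servingZ_withDensity_pathLoss hβ, S.map_servingZ,
    lintegral_withDensity_eq_lintegral_mul _ (by fun_prop) hnm,
    lintegral_withDensity_eq_lintegral_mul _ (by fun_prop) (by fun_prop)]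
  refine setLIntegral_congr_fun measurableSet_Ioi fun u hu => ?_
  have hu₀ : 0 < u := hu
  simp only [Pi.mul_apply, hnoise]
  rw [← ENNReal.ofReal_mul (by positivity), expNeg_ofReal (by positivity),
    ← ENNReal.ofReal_mul (laplaceFormula_nonneg _ _ _ _ _), ← ENNReal.ofReal_mul (by positivity),
    coverageIntegrand, mul_right_comm β]
  congr 1
  ring

lemma integrableOn_coverageIntegrand (S : D.IsRegular b powerLaw M P) {β : ℝ} (hβ : 0 < β) :
    IntegrableOn (coverageIntegrand D b β M) (Ioi 0) := by
  refine ⟨(measurable_coverageIntegrand D b β M).aestronglyMeasurable, ?_⟩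
  rw [hasFiniteIntegral_iff_ofReal (.of_forall fun z => S.coverageIntegrand_nonneg β z),
    ← S.measure_lt_sinr hβ]
  exact measure_lt_top _ _

lemma measureReal_lt_sinr (S : D.IsRegular b powerLaw M P) {β : ℝ} (hβ : 0 < β) :
    P.real {ω | ENNReal.ofReal β < D.sinr b ω} = ∫ z in Ioi 0, coverageIntegrand D b β M z := by
  rw [measureReal_def, S.measure_lt_sinr hβ, integral_eq_lintegral_of_nonneg_ae
    (.of_forall fun z => S.coverageIntegrand_nonneg β z)
    (measurable_coverageIntegrand D b β M).aestronglyMeasurable]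

end IsRegular

end Downlink

end SpectrumSharing

end

theorem theorem1_general {O Ω : Type*} [DecidableEq O] [MeasurableSpace Ω] (P : Measure Ω)
    [IsProbabilityMeasure P] (D : Downlink O Ω) (b : O) (hseller : D.seller ∈ D.group)
    (hbuyer : b ∈ D.group) (hne : b ≠ D.seller) (hintensity : 0 < D.intensity b) (hα : 2 < D.α)
    (hpower : 0 < D.sellerPower) (powerLaw : Measure ℝ) (hpos : ∀ᵐ p ∂powerLaw, 0 < p)
    (hint : Integrable (fun p => p ^ (2 / D.α)) powerLaw) (hD : D.IsModel powerLaw P) (β : ℝ)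
    (hβ : 0 < β) (M : ℝ) (hM : M = ∫ p, p ^ (2 / D.α) ∂powerLaw) :
    (IntegrableOn (fun v : ℝ => 1 / (1 + v ^ (D.α / 2))) (Ioi 0) ∧
      ∀ᵐ ω ∂P, D.interference b ω ≠ ∞) ∧
    P[fun ω => Real.exp (-(β * D.servingZ b ω ^ (D.α / 2) * (D.interference b ω).toReal)) |
        MeasurableSpace.comap (D.servingZ b) inferInstance]
      =ᵐ[P] (fun ω => laplaceFormula D b β M (β * D.servingZ b ω ^ (D.α / 2))) ∧
    IntegrableOn (coverageIntegrand D b β M) (Ioi 0) ∧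
    P.real {ω | ENNReal.ofReal β < D.sinr b ω} = ∫ z in Ioi 0, coverageIntegrand D b β M z := by
  have S : D.IsRegular b powerLaw M P :=
    ⟨hD, hseller, hbuyer, hne, hintensity, hα, hpower, hpos, hint, hM⟩
  exact ⟨⟨integrableOn_one_div_one_add_rpow S.one_lt_half, S.ae_interference_ne_top⟩,
    S.condExp_interference hβ, S.integrableOn_coverageIntegrand hβ, S.measureReal_lt_sinr hβ⟩

theorem theorem1 {O Ω Ω' : Type*} [DecidableEq O] [MeasurableSpace Ω] [MeasurableSpace Ω']
    (P : Measure Ω) [IsProbabilityMeasure P] (P' : Measure Ω') [IsProbabilityMeasure P']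
    (D : Downlink O Ω) (b : O)
    (hseller : D.seller ∈ D.group) (hbuyer : b ∈ D.group) (hne : b ≠ D.seller)
    (hintensity : ∀ k ∈ D.group, 0 < D.intensity k)
    (hα : 2 < D.α) (hpower : 0 < D.sellerPower)
    -- the users of the seller, seen from a buyer base station at `x`
    (userIntensity : ℝ≥0) (huser : 0 < userIntensity) (ζ : ℝ) (hζ : 0 < ζ)
    (Y : ℕ → Ω' → Plane) (g : ℕ → Ω' → ℝ) (hY : IsUserField Y g userIntensity P') (x : Plane)
    (hD : D.IsModel (P'.map (maxPower D.α ζ x Y g)) P)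
    (β : ℝ) (hβ : 0 < β) (M : ℝ)
    (hM : M = ∫ ω, maxPower D.α ζ x Y g ω ^ (2 / D.α) ∂P') :
    -- the quantities in the formula are well defined
    (Integrable (fun ω => maxPower D.α ζ x Y g ω ^ (2 / D.α)) P' ∧
      IntegrableOn (fun v : ℝ => 1 / (1 + v ^ (D.α / 2))) (Ioi 0) ∧
      (∀ᵐ ω ∂P, D.interference b ω ≠ ∞)) ∧
    -- the Laplace transform of the interference, given the serving base station
    P[fun ω => Real.exp (-(β * D.servingZ b ω ^ (D.α / 2) * (D.interference b ω).toReal)) |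
        MeasurableSpace.comap (D.servingZ b) inferInstance]
      =ᵐ[P] (fun ω => laplaceFormula D b β M (β * D.servingZ b ω ^ (D.α / 2))) ∧
    -- the coverage probability
    IntegrableOn (coverageIntegrand D b β M) (Ioi 0) ∧
    P.real {ω | ENNReal.ofReal β < D.sinr b ω} = ∫ z in Ioi 0, coverageIntegrand D b β M z := by
  have hα₀ : 0 < D.α := two_pos.trans hα
  have hint := hY.integrable_maxPower_rpow huser hα₀ x hζ
  have hgen := theorem1_general P D b hseller hbuyer hne (hintensity b hbuyer) hα hpower _
    (hY.ae_map_maxPower_pos huser hα₀ x hζ) ((hY.integrable_rpow_map_maxPower_iff _ ζ x _).2 hint)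
    hD β hβ M (hM.trans (hY.integral_rpow_map_maxPower _ ζ x _).symm)
  exact ⟨⟨hint, hgen.1⟩, hgen.2⟩
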